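/- **Setting.** Let $\delta\in(0,1)$, let $X\subset\mathbb R_+$ be a Borel set with $0\in X$, and let $x_0>0$. Alternatives $x_1,x_2,\dots$ are i.i.d. draws from a distribution $F$ (an environment). After each history $h_t=(x_0,x_1,\dots,x_t)$ an individual either stops and takes the best-so-far alternative $y_t=\max\{x_0,\dots,x_t\}$, or waits for another alternative; payoffs are discounted by $\delta$ per round, and never stopping yields $0$. A decision rule $p$ gives (measurably), for each history $h_t$, the probability $p(h_t)\in[0,1]$ of stopping after it. Let $\mathcal F_X$ be the set of all probability distributions over $X$ with a finite mean, and let $\mathcal B_X\subset\mathcal F_X$ be the set of binary environments, i.e. lotteries over $0$ and $z$ with probabilities $1-\sigma$ and $\sigma$, where $z\in X$, $\sigma\in[0,1]$. Let $U_p(F,h)$ be the expected payoff of $p$ under $F$ from history $h$ on, so that $$U_p(F,h_t)=p(h_t)\,y_t+(1-p(h_t))\,\delta\int_X U_p(F,(h_t,x))\,dF(x).$$ For a prior $\mu$ (a probability distribution with finite support over $\mathcal F_X$) that is consistent with $h$ (the alternatives in $h$ occur with positive probability under $\mu$), let $U_p(\mu,h)=\sum_F\mu(F\mid h)\,U_p(F,h)$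 with the Bayesian posterior $\mu(\cdot\mid h)$. Let $V(F,h)=\sup_pU_p(F,h)$, $V(\mu,h)=\sup_p U_p(\mu,h)$, and let $$R_p(x_0,\mathcal F_X)=\inf_{h}\ \inf_{\mu}\ \frac{U_p(\mu,h)}{V(\mu,h)},$$ where $h$ ranges over all finite histories that start with $x_0$ and continue with alternatives in $X$, and $\mu$ over all priors over $\mathcal F_X$ that are consistent with $h$. A rule is *stationary* if its stopping probability is a function $p(y)$ of the best-so-far alternative $y\ge x_0$ only; for such a rule and an environment $F$, let $U_p(F,y)$ and $V(F,y)$ denote the payoff of $p$ and the optimal payoff when the best-so-far alternative is $y$. A stationary rule is *monotone* if $p(y)$ is weakly increasing in $y\ge x_0$, and it has the *monotone ratio property* if $r_p(y)=\inf_{F\in\mathcal B_X}U_p(F,y)/V(F,y)$ is weakly increasing in $y\ge x_0$. **Proposition.** For each decision rule $p$ there exists a stationary monotone decision rule $\tilde p$ with the monotone ratio property such that $$R_{\tilde p}(x_0,\mathcal F_X)\ \ge\ R_p(x_0,\mathcal F_X).$$ -/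

import Mathlib

open MeasureTheory Set
open scoped ENNReal NNReal

noncomputable section

namespace RobustSearch

/-- A history `(x₀, x₁, …, x_t)`: the outside option followed by `t` observed alternatives. -/
abbrev History (t : ℕ) : Type := Fin (t + 1) → ℝ

/-- The history `h ⊕ x` in which the alternative `x` has been appended to `h`. -/
def History.append {t : ℕ} (h : History t) (x : ℝ) : History (t + 1) :=
  Fin.snoc (α := fun _ => ℝ) h x

/-- The best-so-far alternative `max {x₀, …, x_t}`. -/
def History.best {t : ℕ} (h : History t) : ℝ :=
  Finset.univ.sup' Finset.univ_nonempty h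

theorem History.measurable_best (t : ℕ) :
    Measurable (History.best : History t → ℝ) := by
  have h := Finset.measurable_sup' (s := (Finset.univ : Finset (Fin (t + 1))))
    Finset.univ_nonempty (f := fun i (h : History t) => h i) (fun i _ => measurable_pi_apply i)
  convert h using 1
  ext h
  simp [History.best]

/-- The histories with outside option `x₀` and alternatives in `X`. -/
def histories (X : Set ℝ) (x₀ : ℝ) (t : ℕ) : Set (History t) :=
  {h | h 0 = x₀ ∧ ∀ i : Fin t, h i.succ ∈ X}

/-- A decision rule prescribes a stopping probability after each history. -/
structure DecisionRule where
  prob : (t : ℕ) → History t → unitInterval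
  measurable_prob : ∀ t, Measurable (prob t)

/-- A stationary decision rule: the stopping probability is a function of the best-so-far
alternative. -/
structure StationaryRule where
  prob : ℝ → unitInterval
  measurable_prob : Measurable prob

/-- The decision rule given by a stationary rule. -/
def StationaryRule.toRule (q : StationaryRule) : DecisionRule where
  prob _ h := q.prob h.best
  measurable_prob t := q.measurable_prob.comp (History.measurable_best t)

/-- The set `𝓕_X` of all environments: probability distributions over `X` with a finite mean. -/
def environments (X : Set ℝ) : Set (Measure ℝ) :=
  {F | IsProbabilityMeasure F ∧ F Xᶜ = 0 ∧ Integrable (fun x : ℝ => x) F}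

/-- The binary environment: a lottery over `0` and `z`
with probabilities `1 - σ` and `σ`. -/
def binary (z σ : ℝ) : Measure ℝ :=
  ENNReal.ofReal (1 - σ) • Measure.dirac 0 + ENNReal.ofReal σ • Measure.dirac z

/-- The set `𝓑_X` of all binary environments over `X`. -/
def binaryEnvironments (X : Set ℝ) : Set (Measure ℝ) :=
  {F | ∃ z ∈ X, ∃ σ ∈ Icc (0 : ℝ) 1, F = binary z σ}

/-- The expected discounted payoff of the rule `p` in the environment `F` after the history `h`
that is collected in the next `n` decisions, that is, when nothing is obtained unless the rule
stops at one of the next `n` decisions. -/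
def payoffUpTo (δ : ℝ) (p : DecisionRule) (F : Measure ℝ) :
    ℕ → {t : ℕ} → History t → ℝ≥0∞
  | 0, _, _ => 0
  | n + 1, t, h =>
      ENNReal.ofReal (p.prob t h) * ENNReal.ofReal h.best +
        ENNReal.ofReal (1 - (p.prob t h : ℝ)) *
          (ENNReal.ofReal δ * ∫⁻ x, payoffUpTo δ p F n (h.append x) ∂F)

/-- The expected payoff `U_p(F, h)` of the rule `p` in the environment `F` after the history `h`.
Never stopping gives the payoff zero, and all payoffs are nonnegative, so this is the increasing
limit of the payoffs collected in finitely many rounds. -/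
def payoff (δ : ℝ) (p : DecisionRule) (F : Measure ℝ) {t : ℕ} (h : History t) : ℝ≥0∞ :=
  ⨆ n, payoffUpTo δ p F n h

/-- The optimal payoff `V(F, h)` in the environment `F` after the history `h`. -/
def optPayoff (δ : ℝ) (F : Measure ℝ) {t : ℕ} (h : History t) : ℝ≥0∞ :=
  ⨆ p : DecisionRule, payoff δ p F h

/-- The set `Δ(𝓕)` of priors: the probability distributions with a finite support over `𝓕`. -/
def priors (𝓕 : Set (Measure ℝ)) : Set (Measure ℝ →₀ ℝ≥0) :=
  {μ | (μ.support : Set (Measure ℝ)) ⊆ 𝓕 ∧ (μ.sum fun _ w => w) = 1}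

/-- The probability that the alternatives `x₁, …, x_t` of the history `h` occur under `F`. -/
def likelihood (F : Measure ℝ) {t : ℕ} (h : History t) : ℝ≥0∞ :=
  ∏ i : Fin t, F {h i.succ}

/-- The probability that the alternatives `x₁, …, x_t` of the history `h` occur under a prior. -/
def priorLikelihood (μ : Measure ℝ →₀ ℝ≥0) {t : ℕ} (h : History t) : ℝ≥0∞ :=
  ∑ F ∈ μ.support, (μ F : ℝ≥0∞) * likelihood F h

/-- The priors over `𝓕` that are consistent with the history `h`. -/
def consistentPriors (𝓕 : Set (Measure ℝ)) {t : ℕ} (h : History t) :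
    Set (Measure ℝ →₀ ℝ≥0) :=
  {μ | μ ∈ priors 𝓕 ∧ 0 < priorLikelihood μ h}

/-- The posterior probability `μ(F | h)` of the environment `F`, by Bayes' rule. -/
def posterior (μ : Measure ℝ →₀ ℝ≥0) {t : ℕ} (h : History t) (F : Measure ℝ) : ℝ≥0∞ :=
  (μ F : ℝ≥0∞) * likelihood F h / priorLikelihood μ h

/-- The expected payoff `U_p(μ, h)` of the rule `p` under the prior `μ`, conditional on `h`. -/
def priorPayoff (δ : ℝ) (p : DecisionRule) (μ : Measure ℝ →₀ ℝ≥0) {t : ℕ} (h : History t) :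
    ℝ≥0∞ :=
  ∑ F ∈ μ.support, posterior μ h F * payoff δ p F h

/-- The optimal payoff `V(μ, h)` under the prior `μ`, conditional on `h`. -/
def priorOptPayoff (δ : ℝ) (μ : Measure ℝ →₀ ℝ≥0) {t : ℕ} (h : History t) : ℝ≥0∞ :=
  ⨆ p : DecisionRule, priorPayoff δ p μ h

/-- The performance ratio `R_p(x₀, 𝓕)`: the infimum of the payoff ratio over all histories with
outside option `x₀` and all priors over `𝓕` that are consistent with the history. -/
def performanceRatio (δ : ℝ) (X : Set ℝ) (p : DecisionRule) (x₀ : ℝ) (𝓕 : Set (Measure ℝ)) :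
    ℝ≥0∞ :=
  ⨅ (t : ℕ) (h ∈ histories X x₀ t) (μ ∈ consistentPriors 𝓕 h),
    priorPayoff δ p μ h / priorOptPayoff δ μ h

/-- The ratio `r_q(y)` of a stationary rule: the infimum of the payoff ratio over all binary
environments when the best-so-far alternative is `y`. -/
def binaryRatio (δ : ℝ) (X : Set ℝ) (q : StationaryRule) (y : ℝ) : ℝ≥0∞ :=
  ⨅ F ∈ binaryEnvironments X,
    payoff δ q.toRule F (fun _ : Fin 1 => y : History 0) /
      optPayoff δ F (fun _ : Fin 1 => y : History 0)

/-- A stationary rule is monotone if the stopping probability is weakly increasing in the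
best-so-far alternative; with outside option `x₀` the latter ranges over `[x₀, ∞)`. -/
def StationaryRule.IsMonotone (q : StationaryRule) (x₀ : ℝ) : Prop :=
  MonotoneOn q.prob (Ici x₀)

/-- The monotone ratio property: `r_q` is weakly increasing in the best-so-far alternative. -/
def StationaryRule.HasMonotoneRatio (δ : ℝ) (X : Set ℝ) (q : StationaryRule) (x₀ : ℝ) : Prop :=
  MonotoneOn (binaryRatio δ X q) (Ici x₀)

end RobustSearch

end

noncomputable section

namespace RobustSearch

/-! ### Histories -/

/-! Describe a stationary rule by its profile `w`, where `w y` is the expected discount factor at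
stopping if the best-so-far alternative `y` is never improved upon. By Weitzman's formula the
optimal payoff is `max y c`, where `c = δ * E[max c x]` is the reservation value
(`IsReservation.optPayoff_eq`). Point priors and posterior averaging reduce the performance ratio to
single environments.

To guarantee a fraction `R > 0` it suffices that `w` is monotone with values in `[R, 1]` and
satisfies one inequality per binary environment with reservation value above `y` (`IsFeasible`). For
a general environment, the continuation payoff dominates an affine function of `max c x`. The
reservation equation fixes the mean of that function, and domination at each single `x` is a binary
condition (`payoffBound_le_step`).

An arbitrary rule with guarantee `R` yields a feasible profile: the supremum of its relative
payoffs, over consistent histories with best at most `y`, in environments that never improve on the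
history (`ruleProfile`). Until `z` appears, such an environment `F` cannot be told apart from `F`
mixed with a small chance of `z`. The patience needed in the mixture therefore costs payoff in `F`,
which forces the binary inequality (`ruleProfile_binary_le`).

The pointwise supremum of all feasible profiles is again feasible. Where it is below one, its binary
ratio must equal `R`, or it could be raised (`IsFeasible.exists_lt`). Where it equals one, the rule
stops at once, and the ratio increases from there on. This gives the monotone ratio property. -/

theorem History.le_best {t : ℕ} (h : History t) (i : Fin (t + 1)) : h i ≤ h.best :=
  Finset.le_sup' h (Finset.mem_univ i)

@[simp]
theorem History.append_castSucc {t : ℕ} (h : History t) (x : ℝ) (i : Fin (t + 1)) :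
    h.append x i.castSucc = h i :=
  Fin.snoc_castSucc (α := fun _ => ℝ) x h i

@[simp]
theorem History.append_last {t : ℕ} (h : History t) (x : ℝ) :
    h.append x (Fin.last (t + 1)) = x :=
  Fin.snoc_last (α := fun _ => ℝ) x h

@[simp]
theorem History.append_castSucc_succ {t : ℕ} (h : History t) (x : ℝ) (i : Fin t) :
    h.append x i.castSucc.succ = h i.succ := by
  rw [Fin.succ_castSucc, History.append_castSucc]

@[simp]
theorem History.append_last_succ {t : ℕ} (h : History t) (x : ℝ) :
    h.append x (Fin.last t).succ = x := by
  rw [Fin.succ_last, History.append_last]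

theorem History.best_append {t : ℕ} (h : History t) (x : ℝ) :
    (h.append x).best = max h.best x := by
  apply le_antisymm
  · refine Finset.sup'_le _ _ fun i _ => ?_
    induction i using Fin.lastCases with
    | last => simp
    | cast j => simpa using Or.inl (h.le_best j)
  · refine max_le (Finset.sup'_le _ _ fun i _ => ?_) ?_
    · simpa using (h.append x).le_best i.castSucc
    · simpa using (h.append x).le_best (Fin.last _)

theorem History.best_const (y : ℝ) : History.best (fun _ : Fin 1 => y : History 0) = y := by
  simp [History.best]

theorem History.append_mem {X : Set ℝ} {x₀ : ℝ} {t : ℕ} {h : History t}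
    (hh : h ∈ histories X x₀ t) {x : ℝ} (hx : x ∈ X) : h.append x ∈ histories X x₀ (t + 1) := by
  refine ⟨?_, fun i => ?_⟩
  · rw [← hh.1, ← Fin.castSucc_zero, History.append_castSucc]
  · induction i using Fin.lastCases with
    | last => simpa using hx
    | cast j => simpa using hh.2 j

theorem History.le_best_of_mem {X : Set ℝ} {x₀ : ℝ} {t : ℕ} {h : History t}
    (hh : h ∈ histories X x₀ t) : x₀ ≤ h.best :=
  hh.1 ▸ h.le_best 0

theorem History.measurable_append (t : ℕ) :
    Measurable fun a : History t × ℝ => a.1.append a.2 := by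
  refine measurable_pi_iff.2 fun i => ?_
  induction i using Fin.lastCases with
  | last => simpa using measurable_snd
  | cast j =>
    simp only [History.append_castSucc]
    exact (measurable_pi_apply j).comp measurable_fst

theorem likelihood_append (F : Measure ℝ) {t : ℕ} (h : History t) (x : ℝ) :
    likelihood F (h.append x) = likelihood F h * F {x} := by
  unfold likelihood
  rw [Fin.prod_univ_castSucc]
  simp

/-! ### Payoffs -/

section Payoff

variable {δ : ℝ} {p : DecisionRule} {F : Measure ℝ}

theorem measurable_payoffUpTo [SFinite F] (n : ℕ) :
    ∀ t : ℕ, Measurable fun h : History t => payoffUpTo δ p F n h := by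
  induction n with
  | zero => intro t; simp only [payoffUpTo]; exact measurable_const
  | succ n ih =>
    intro t
    simp only [payoffUpTo]
    have h1 : Measurable fun h : History t => ((p.prob t h : unitInterval) : ℝ) :=
      measurable_subtype_coe.comp (p.measurable_prob t)
    have h2 : Measurable fun h : History t => ∫⁻ x, payoffUpTo δ p F n (h.append x) ∂F :=
      Measurable.lintegral_prod_right
        (f := fun (h : History t) (x : ℝ) => payoffUpTo δ p F n (h.append x))
        ((ih (t + 1)).comp (History.measurable_append t))
    exact (h1.ennreal_ofReal.mul (History.measurable_best t).ennreal_ofReal).add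
      ((measurable_const.sub h1).ennreal_ofReal.mul (measurable_const.mul h2))

theorem measurable_payoff [SFinite F] (t : ℕ) :
    Measurable fun h : History t => payoff δ p F h :=
  Measurable.iSup fun n => measurable_payoffUpTo n t

theorem measurable_payoff_append [SFinite F] {t : ℕ} (h : History t) :
    Measurable fun x => payoff δ p F (h.append x) :=
  (measurable_payoff (t + 1)).comp ((History.measurable_append t).comp measurable_prodMk_left)

theorem prob_nonneg (p : DecisionRule) {t : ℕ} (h : History t) : (0 : ℝ) ≤ p.prob t h :=
  (p.prob t h).2.1

theorem prob_le_one (p : DecisionRule) {t : ℕ} (h : History t) : (p.prob t h : ℝ) ≤ 1 :=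
  (p.prob t h).2.2

theorem payoffUpTo_succ_le (hδ : 0 ≤ δ) (n : ℕ) {t : ℕ} (h : History t) (hb : 0 ≤ h.best)
    {f : ℝ → ℝ} (hf : Integrable f F) (hf₀ : 0 ≤ᵐ[F] f)
    (hle : ∀ᵐ x ∂F, payoffUpTo δ p F n (h.append x) ≤ ENNReal.ofReal (f x)) :
    payoffUpTo δ p F (n + 1) h ≤
      ENNReal.ofReal (p.prob t h * h.best + (1 - p.prob t h) * (δ * ∫ x, f x ∂F)) := by
  have h0 := prob_nonneg p h
  have h1 := prob_le_one p h
  have hI : 0 ≤ ∫ x, f x ∂F := integral_nonneg_of_ae hf₀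
  rw [ENNReal.ofReal_add (by positivity) (mul_nonneg (by linarith) (by positivity)),
    ENNReal.ofReal_mul h0, ENNReal.ofReal_mul (by linarith), ENNReal.ofReal_mul hδ,
    ofReal_integral_eq_lintegral_ofReal hf hf₀]
  simp only [payoffUpTo]
  exact add_le_add_right (mul_le_mul_right (mul_le_mul_right (lintegral_mono_ae hle) _) _) _

theorem ofReal_integral_le_lintegral {f : ℝ → ℝ} (hf : Integrable f F) :
    ENNReal.ofReal (∫ x, f x ∂F) ≤ ∫⁻ x, ENNReal.ofReal (f x) ∂F := by
  have h1 : Integrable (fun x => max (f x) 0) F := hf.pos_part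
  calc ENNReal.ofReal (∫ x, f x ∂F) ≤ ENNReal.ofReal (∫ x, max (f x) 0 ∂F) :=
        ENNReal.ofReal_le_ofReal (integral_mono hf h1 fun x => le_max_left _ _)
    _ = ∫⁻ x, ENNReal.ofReal (max (f x) 0) ∂F :=
        ofReal_integral_eq_lintegral_ofReal h1 (ae_of_all _ fun x => le_max_right _ _)
    _ = ∫⁻ x, ENNReal.ofReal (f x) ∂F := by simp [ENNReal.ofReal_max]

/-- Unlike in the upper bound, `f` may be negative, because `ENNReal.ofReal` truncates. This leaves
room for the error terms that later inductions subtract. -/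
theorem le_payoffUpTo_succ (hδ : 0 ≤ δ) (n : ℕ) {t : ℕ} (h : History t)
    {f : ℝ → ℝ} (hf : Integrable f F)
    (hle : ∀ᵐ x ∂F, ENNReal.ofReal (f x) ≤ payoffUpTo δ p F n (h.append x)) :
    ENNReal.ofReal (p.prob t h * h.best + (1 - p.prob t h) * (δ * ∫ x, f x ∂F)) ≤
      payoffUpTo δ p F (n + 1) h := by
  have h0 := prob_nonneg p h
  have h1 := prob_le_one p h
  refine ENNReal.ofReal_add_le.trans ?_
  rw [ENNReal.ofReal_mul h0, ENNReal.ofReal_mul (by linarith), ENNReal.ofReal_mul hδ]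
  simp only [payoffUpTo]
  exact add_le_add_right (mul_le_mul_right (mul_le_mul_right
    ((ofReal_integral_le_lintegral hf).trans (lintegral_mono_ae hle)) _) _) _

theorem payoffUpTo_le_payoff (n : ℕ) {t : ℕ} (h : History t) :
    payoffUpTo δ p F n h ≤ payoff δ p F h :=
  le_iSup (fun n => payoffUpTo δ p F n h) n

theorem payoff_le_succ (hδ : 0 ≤ δ) {t : ℕ} (h : History t) (hb : 0 ≤ h.best)
    {f : ℝ → ℝ} (hf : Integrable f F) (hf₀ : 0 ≤ᵐ[F] f)
    (hle : ∀ᵐ x ∂F, payoff δ p F (h.append x) ≤ ENNReal.ofReal (f x)) :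
    payoff δ p F h ≤
      ENNReal.ofReal (p.prob t h * h.best + (1 - p.prob t h) * (δ * ∫ x, f x ∂F)) := by
  refine iSup_le fun n => ?_
  cases n with
  | zero => simp [payoffUpTo]
  | succ n =>
    exact payoffUpTo_succ_le hδ n h hb hf hf₀
      (hle.mono fun x hx => (payoffUpTo_le_payoff n _).trans hx)

theorem payoff_le_of_ae_le [IsProbabilityMeasure F] (hδ : 0 ≤ δ) (hδ₁ : δ ≤ 1) {b : ℝ}
    (hF : ∀ᵐ x ∂F, x ≤ b) {t : ℕ} (h : History t) (hb₀ : 0 ≤ h.best) (hb : h.best ≤ b) :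
    payoff δ p F h ≤ ENNReal.ofReal b := by
  refine iSup_le fun n => ?_
  induction n generalizing t with
  | zero => simp [payoffUpTo]
  | succ n ih =>
    refine (payoffUpTo_succ_le (f := fun _ => b) hδ n h hb₀ (integrable_const b)
      (ae_of_all _ fun _ => hb₀.trans hb) (hF.mono fun x hx => ?_)).trans ?_
    · exact ih _ (by rw [History.best_append]; exact hb₀.trans (le_max_left _ _))
        (by rw [History.best_append]; exact max_le hb hx)
    · apply ENNReal.ofReal_le_ofReal
      have h0 := prob_nonneg p h
      have h1 := prob_le_one p h
      have h2 : δ * b ≤ b := mul_le_of_le_one_left (hb₀.trans hb) hδ₁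
      simp only [integral_const, probReal_univ, smul_eq_mul, one_mul]
      nlinarith

end Payoff

/-! ### Reservation values -/

/-- `c` is a reservation value of the environment `F`: the value of searching on when recall of
`c` is available is `c`. -/
structure IsReservation (δ : ℝ) (F : Measure ℝ) (c : ℝ) : Prop where
  nonneg : 0 ≤ c
  eq : c = δ * ∫ x, max c x ∂F

theorem integrable_max_const {F : Measure ℝ} [IsProbabilityMeasure F]
    (hF : Integrable (fun x : ℝ => x) F) (c : ℝ) : Integrable (fun x => max c x) F :=
  (integrable_const c).sup hF

theorem exists_isReservation {δ : ℝ} (hδ₀ : 0 < δ) (hδ₁ : δ < 1) {F : Measure ℝ}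
    [IsProbabilityMeasure F] (hF : Integrable (fun x : ℝ => x) F) :
    ∃ c, IsReservation δ F c := by
  have hlip : LipschitzWith 1 fun c => ∫ x, max c x ∂F := by
    refine LipschitzWith.of_dist_le_mul fun c d => ?_
    rw [Real.dist_eq, ← integral_sub (integrable_max_const hF c) (integrable_max_const hF d)]
    have := norm_integral_le_of_norm_le_const (μ := F) (f := fun x => max c x - max d x)
      (C := |c - d|) (ae_of_all _ fun x => by
        simpa using abs_max_sub_max_le_abs c d x)
    simpa [Real.dist_eq] using this
  set m := ∫ x, |x| ∂F
  have hm : 0 ≤ m := integral_nonneg fun x => abs_nonneg x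
  -- Since `max C x ≤ C + |x|`, this choice gives `δ * E[max C x] ≤ δ * (C + m) ≤ C`, the second
  -- sign needed for the intermediate value theorem.
  set C := m / (1 - δ)
  have hδ' : 0 < 1 - δ := by linarith
  have hC : 0 ≤ C := by positivity
  have hCm : C * (1 - δ) = m := div_mul_cancel₀ _ hδ'.ne'
  have hcont : ContinuousOn (fun c => c - δ * ∫ x, max c x ∂F) (Icc 0 C) :=
    (continuous_id.sub (continuous_const.mul hlip.continuous)).continuousOn
  have h0 : (0 : ℝ) - δ * ∫ x, max 0 x ∂F ≤ 0 := by
    have : 0 ≤ ∫ x, max 0 x ∂F := integral_nonneg fun x => le_max_left _ _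
    nlinarith [mul_nonneg hδ₀.le this]
  have h1 : 0 ≤ C - δ * ∫ x, max C x ∂F := by
    have : ∫ x, max C x ∂F ≤ ∫ x, (C + |x|) ∂F :=
      integral_mono (integrable_max_const hF C) ((integrable_const C).add hF.abs) fun x =>
        max_le (by linarith [abs_nonneg x]) (by linarith [le_abs_self x])
    rw [integral_add (integrable_const C) hF.abs] at this
    simp only [integral_const, probReal_univ, smul_eq_mul, one_mul] at this
    nlinarith [mul_le_mul_of_nonneg_left this hδ₀.le]
  obtain ⟨c, hc, hc0⟩ := intermediate_value_Icc hC hcont ⟨h0, h1⟩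
  exact ⟨c, hc.1, by simpa [sub_eq_zero] using hc0⟩

section Reservation

variable {δ c : ℝ} {F : Measure ℝ} [IsProbabilityMeasure F]

/-- Waiting cannot raise the candidate value `max b c`: pointwise `max (max b x) c ≤ max c x + (max
b c - c)`, and the mean of `max c x` is known. -/
theorem IsReservation.integral_le (hc : IsReservation δ F c) (hδ₀ : 0 ≤ δ) (hδ₁ : δ ≤ 1)
    (hF : Integrable (fun x : ℝ => x) F) (b : ℝ) :
    δ * ∫ x, max (max b x) c ∂F ≤ max b c := by
  have h1 : ∫ x, max (max b x) c ∂F ≤ ∫ x, (max c x + (max b c - c)) ∂F := by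
    refine integral_mono (((integrable_max_const hF b)).sup (integrable_const c))
      ((integrable_max_const hF c).add (integrable_const _)) fun x => ?_
    have := le_max_left c x
    have := le_max_right c x
    have := le_max_left b c
    have := le_max_right b c
    simp only
    refine max_le (max_le ?_ ?_) ?_ <;> linarith
  rw [integral_add (integrable_max_const hF c) (integrable_const _)] at h1
  simp only [integral_const, probReal_univ, smul_eq_mul, one_mul] at h1
  have h2 := mul_le_mul_of_nonneg_left h1 hδ₀
  have h3 := hc.eq
  have h4 : 0 ≤ max b c - c := by linarith [le_max_right b c]
  nlinarith

theorem IsReservation.payoff_le (hc : IsReservation δ F c) (hδ₀ : 0 ≤ δ) (hδ₁ : δ ≤ 1)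
    (hF : Integrable (fun x : ℝ => x) F) (p : DecisionRule) {t : ℕ} (h : History t)
    (hb : 0 ≤ h.best) : payoff δ p F h ≤ ENNReal.ofReal (max h.best c) := by
  refine iSup_le fun n => ?_
  induction n generalizing t with
  | zero => simp [payoffUpTo]
  | succ n ih =>
    refine (payoffUpTo_succ_le (f := fun x => max (max h.best x) c) hδ₀ n h hb
      ((integrable_max_const hF _).sup (integrable_const c))
      (ae_of_all _ fun x => hc.nonneg.trans (le_max_right _ _)) (ae_of_all _ fun x => ?_)).trans ?_
    · rw [← History.best_append]
      exact ih _ (by rw [History.best_append]; exact hb.trans (le_max_left _ _))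
    · apply ENNReal.ofReal_le_ofReal
      have h0 := prob_nonneg p h
      have h1 := prob_le_one p h
      have h2 := hc.integral_le hδ₀ hδ₁ hF h.best
      have h3 := le_max_left h.best c
      nlinarith

/-- The optimum is attained by stopping exactly when the best-so-far alternative reaches `c`.
Truncated to `n + 1` decisions, this rule loses at most `δ ^ n * c`. -/
theorem IsReservation.optPayoff_eq (hc : IsReservation δ F c) (hδ₀ : 0 ≤ δ) (hδ₁ : δ < 1)
    (hF : Integrable (fun x : ℝ => x) F) {t : ℕ} (h : History t)
    (hb : 0 ≤ h.best) : optPayoff δ F h = ENNReal.ofReal (max h.best c) := by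
  apply le_antisymm (iSup_le fun p => hc.payoff_le hδ₀ hδ₁.le hF p h hb)
  let q : StationaryRule :=
    { prob := fun y => if c ≤ y then 1 else 0
      measurable_prob := Measurable.ite measurableSet_Ici measurable_const measurable_const }
  have key : ∀ n : ℕ, ∀ {t : ℕ} (h : History t), 0 ≤ h.best →
      ENNReal.ofReal (max h.best c - δ ^ n * c) ≤ payoffUpTo δ q.toRule F (n + 1) h := by
    intro n
    induction n with
    | zero =>
      intro t h hb
      by_cases hcb : c ≤ h.best
      · have : payoffUpTo δ q.toRule F (0 + 1) h = ENNReal.ofReal h.best := by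
          simp [payoffUpTo, StationaryRule.toRule, q, hcb]
        rw [this, max_eq_left hcb]
        exact ENNReal.ofReal_le_ofReal (by simpa using hc.nonneg)
      · rw [max_eq_right (not_le.1 hcb).le]
        simp
    | succ n ih =>
      intro t h hb
      by_cases hcb : c ≤ h.best
      · have : payoffUpTo δ q.toRule F (n + 1 + 1) h = ENNReal.ofReal h.best := by
          rw [payoffUpTo]
          simp [StationaryRule.toRule, q, hcb]
        rw [this, max_eq_left hcb]
        exact ENNReal.ofReal_le_ofReal (by simpa using mul_nonneg (pow_nonneg hδ₀ _) hc.nonneg)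
      · refine le_trans ?_ (le_payoffUpTo_succ
          (f := fun x => max (max h.best x) c - δ ^ n * c) hδ₀ (n + 1) h
          (((integrable_max_const hF _).sup (integrable_const c)).sub (integrable_const _))
          (ae_of_all _ fun x => ?_))
        · have hq : ((q.toRule.prob t h : unitInterval) : ℝ) = 0 := by
            simp [StationaryRule.toRule, q, hcb]
          have hi : Integrable (fun x => max (max h.best x) c) F :=
            (integrable_max_const hF _).sup (integrable_const c)
          rw [hq, integral_sub hi (integrable_const _)]
          have h1 : ∀ x, max (max h.best x) c = max c x := fun x => by
            rw [max_assoc, max_comm x c, ← max_assoc, max_eq_right (not_le.1 hcb).le]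
          simp only [h1, max_eq_right (not_le.1 hcb).le, integral_const, probReal_univ,
            smul_eq_mul, one_mul, zero_mul, zero_add, sub_zero]
          apply ENNReal.ofReal_le_ofReal
          rw [mul_sub, ← hc.eq, pow_succ']
          linarith
        · rw [← History.best_append]
          exact ih _ (by rw [History.best_append]; exact hb.trans (le_max_left _ _))
  refine le_trans ?_ (le_iSup _ q.toRule)
  have hlim : Filter.Tendsto (fun n : ℕ => ENNReal.ofReal (max h.best c - δ ^ n * c))
      Filter.atTop (nhds (ENNReal.ofReal (max h.best c - 0 * c))) :=
    (ENNReal.continuous_ofReal.tendsto _).comp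
      (((tendsto_pow_atTop_nhds_zero_of_lt_one hδ₀ hδ₁).mul_const c).const_sub _)
  rw [zero_mul, sub_zero] at hlim
  exact le_of_tendsto' hlim fun n => (key n h hb).trans (payoffUpTo_le_payoff _ h)

end Reservation

/-! ### Performance ratios -/

theorem likelihood_ne_top (F : Measure ℝ) [IsProbabilityMeasure F] {t : ℕ} (h : History t) :
    likelihood F h ≠ ⊤ :=
  ENNReal.prod_ne_top fun _ _ => measure_ne_top _ _

theorem performanceRatio_mul_le {δ : ℝ} {X : Set ℝ} {p : DecisionRule} {x₀ : ℝ}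
    {F : Measure ℝ} (hF : F ∈ environments X) {t : ℕ} {h : History t}
    (hh : h ∈ histories X x₀ t) (hl : likelihood F h ≠ 0)
    (h0 : optPayoff δ F h ≠ 0) (hT : optPayoff δ F h ≠ ⊤) :
    performanceRatio δ X p x₀ (environments X) * optPayoff δ F h ≤ payoff δ p F h := by
  have := hF.1
  have hs : (Finsupp.single F (1 : ℝ≥0)).support = {F} := Finsupp.support_single _ one_ne_zero
  have hpost : posterior (Finsupp.single F 1) h F = 1 := by
    simp [posterior, priorLikelihood, ENNReal.div_self hl (likelihood_ne_top F h)]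
  have hpay : ∀ p, priorPayoff δ p (Finsupp.single F 1) h = payoff δ p F h := fun p => by
    simp [priorPayoff, hpost]
  have hcons : Finsupp.single F (1 : ℝ≥0) ∈ consistentPriors (environments X) h := by
    refine ⟨⟨by simpa [hs] using hF, by simp⟩, ?_⟩
    simpa [priorLikelihood, hs] using pos_iff_ne_zero.2 hl
  have key : performanceRatio δ X p x₀ (environments X) ≤ payoff δ p F h / optPayoff δ F h := by
    refine (iInf_le_of_le t <| iInf₂_le_of_le h hh <| iInf₂_le_of_le _ hcons le_rfl).trans ?_
    simp only [priorOptPayoff, hpay, optPayoff]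
    exact le_rfl
  exact (ENNReal.le_div_iff_mul_le (Or.inl h0) (Or.inl hT)).1 key

/-- Not knowing the environment only lowers the optimum: `V(μ, h)` is at most the posterior mean of
`V(F, h)`, so a bound in each environment averages to one under the prior. -/
theorem le_performanceRatio {δ : ℝ} (hδ₀ : 0 < δ) (hδ₁ : δ < 1) {X : Set ℝ} {p : DecisionRule}
    {x₀ : ℝ} (hx₀ : 0 < x₀) {R : ℝ≥0∞}
    (H : ∀ F ∈ environments X, ∀ (t : ℕ) (h : History t), x₀ ≤ h.best →
      R * optPayoff δ F h ≤ payoff δ p F h) :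
    R ≤ performanceRatio δ X p x₀ (environments X) := by
  refine le_iInf fun t => le_iInf₂ fun h hh => le_iInf₂ fun μ hμ => ?_
  have hb := History.le_best_of_mem hh
  have henv : ∀ F ∈ μ.support, F ∈ environments X := fun F hF => hμ.1.1 hF
  have hV : ∀ F ∈ μ.support, ENNReal.ofReal x₀ ≤ optPayoff δ F h ∧ optPayoff δ F h ≠ ⊤ := by
    intro F hF
    have := (henv F hF).1
    obtain ⟨c, hc⟩ := exists_isReservation hδ₀ hδ₁ (henv F hF).2.2
    rw [hc.optPayoff_eq hδ₀.le hδ₁ (henv F hF).2.2 h (hx₀.le.trans hb)]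
    exact ⟨ENNReal.ofReal_le_ofReal (hb.trans (le_max_left _ _)), ENNReal.ofReal_ne_top⟩
  have hLT : priorLikelihood μ h ≠ ⊤ := ENNReal.sum_ne_top.2 fun F hF => by
    have := (henv F hF).1
    exact ENNReal.mul_ne_top ENNReal.coe_ne_top (likelihood_ne_top F h)
  have hpostT : ∀ F ∈ μ.support, posterior μ h F ≠ ⊤ := fun F hF => by
    have := (henv F hF).1
    exact ENNReal.div_ne_top
      (ENNReal.mul_ne_top ENNReal.coe_ne_top (likelihood_ne_top F h)) hμ.2.ne'
  have hsum : ∑ F ∈ μ.support, posterior μ h F = 1 := by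
    simp only [posterior, div_eq_mul_inv]
    rw [← Finset.sum_mul]
    exact ENNReal.mul_inv_cancel hμ.2.ne' hLT
  have hle : priorOptPayoff δ μ h ≤ ∑ F ∈ μ.support, posterior μ h F * optPayoff δ F h :=
    iSup_le fun p => Finset.sum_le_sum fun F _ => by
      gcongr
      exact le_iSup (fun p => payoff δ p F h) p
  have hT : priorOptPayoff δ μ h ≠ ⊤ := ne_top_of_le_ne_top
    (ENNReal.sum_ne_top.2 fun F hF => ENNReal.mul_ne_top (hpostT F hF) (hV F hF).2) hle
  have hmain : R * priorOptPayoff δ μ h ≤ priorPayoff δ p μ h := by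
    calc R * priorOptPayoff δ μ h
        ≤ R * ∑ F ∈ μ.support, posterior μ h F * optPayoff δ F h := by gcongr
      _ = ∑ F ∈ μ.support, posterior μ h F * (R * optPayoff δ F h) := by
          rw [Finset.mul_sum]
          exact Finset.sum_congr rfl fun F _ => by ring
      _ ≤ priorPayoff δ p μ h := Finset.sum_le_sum fun F hF => by
          gcongr
          exact H F (henv F hF) t h hb
  have h0 : priorOptPayoff δ μ h ≠ 0 := by
    -- Stopping at once earns at least `x₀`, so the denominator is positive.
    let q : DecisionRule := { prob := fun _ _ => 1, measurable_prob := fun _ => measurable_const }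
    have hq : ∀ F, ENNReal.ofReal x₀ ≤ payoff δ q F h := fun F => by
      refine le_trans ?_ (payoffUpTo_le_payoff 1 h)
      simpa [payoffUpTo, q] using ENNReal.ofReal_le_ofReal hb
    have h1 : ENNReal.ofReal x₀ ≤ priorPayoff δ q μ h := by
      calc ENNReal.ofReal x₀ = ∑ F ∈ μ.support, posterior μ h F * ENNReal.ofReal x₀ := by
            rw [← Finset.sum_mul, hsum, one_mul]
        _ ≤ _ := Finset.sum_le_sum fun F _ => by gcongr; exact hq F
    have h2 := h1.trans (le_iSup (fun q => priorPayoff δ q μ h) q)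
    exact ((ENNReal.ofReal_pos.2 hx₀).trans_le h2).ne'
  exact (ENNReal.le_div_iff_mul_le (Or.inl h0) (Or.inl hT)).2 hmain

/-! ### Stationary rules from profiles

A stationary rule is described by its profile `w`: if the best-so-far alternative `y` will never
be improved upon, then the payoff of the rule is `w y * y`. -/

/-- The constant stopping probability whose expected discount factor at stopping is `w`. -/
def stopProb (δ w : ℝ) : ℝ := (1 - δ) * w / (1 - δ * w)

section StopProb

variable {δ w : ℝ}

theorem one_sub_mul_pos (hδ₀ : 0 < δ) (hδ₁ : δ < 1) (hw : w ≤ 1) : 0 < 1 - δ * w := by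
  nlinarith

/-- This is the fixed-point equation `s + (1 - s) * δ * w = w` for the stopping probability `s`,
cleared of denominators. -/
theorem stopProb_mul (hδ₀ : 0 < δ) (hδ₁ : δ < 1) (hw : w ≤ 1) :
    stopProb δ w * (1 - δ * w) = (1 - δ) * w :=
  div_mul_cancel₀ _ (one_sub_mul_pos hδ₀ hδ₁ hw).ne'

theorem stopProb_nonneg (hδ₀ : 0 < δ) (hδ₁ : δ < 1) (hw₀ : 0 ≤ w) (hw : w ≤ 1) :
    0 ≤ stopProb δ w :=
  div_nonneg (mul_nonneg (by linarith) hw₀) (one_sub_mul_pos hδ₀ hδ₁ hw).le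

theorem stopProb_le_one (hδ₀ : 0 < δ) (hδ₁ : δ < 1) (hw : w ≤ 1) : stopProb δ w ≤ 1 := by
  rw [stopProb, div_le_one (one_sub_mul_pos hδ₀ hδ₁ hw)]
  linarith

theorem stopProb_mono {v : ℝ} (hδ₀ : 0 < δ) (hδ₁ : δ < 1) (hvw : v ≤ w) (hw : w ≤ 1) :
    stopProb δ v ≤ stopProb δ w := by
  rw [stopProb, stopProb, div_le_div_iff₀ (one_sub_mul_pos hδ₀ hδ₁ (hvw.trans hw))
    (one_sub_mul_pos hδ₀ hδ₁ hw)]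
  nlinarith

end StopProb

/-- The stationary rule with profile `w`. -/
def profileRule (δ : ℝ) (w : ℝ → ℝ) (hw : Monotone w) : StationaryRule where
  -- The projection only serves the type; it is inactive for profiles with values in `[0, 1]`.
  prob y := Set.projIcc (0 : ℝ) 1 zero_le_one (stopProb δ (w y))
  measurable_prob := by
    refine continuous_projIcc.measurable.comp ?_
    exact (hw.measurable.const_mul _).div ((hw.measurable.const_mul _).const_sub _)

/-- Feasible profiles: those that guarantee the fraction `R` of the optimum in the environments
that never improve on the best-so-far alternative and in the binary ones. -/
structure IsFeasible (δ : ℝ) (X : Set ℝ) (x₀ R : ℝ) (w : ℝ → ℝ) : Prop where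
  mono : Monotone w
  le_val : ∀ y, R ≤ w y
  le_one : ∀ y, w y ≤ 1
  -- Here `c` is the reservation value of `binary z σ`. Divided by `1 - δ * w y`, the inequality
  -- says that the rule earns `R * c` at `y` if it earns `R * c` after a failure and `z * w z` after
  -- a success.
  binary_le : ∀ y, x₀ ≤ y → ∀ z ∈ X, ∀ σ, 0 < σ → σ ≤ 1 → ∀ c,
    c * (1 - δ + δ * σ) = δ * σ * z → y < c →
    R * c * (1 - δ * w y) ≤
      (1 - δ) * w y * y + (1 - w y) * (δ * (1 - σ) * (R * c) + δ * σ * (z * w z))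

/-! ### Feasible profiles guarantee `R` in every environment -/

section Feasible

variable {δ x₀ R : ℝ} {X : Set ℝ} {w : ℝ → ℝ}

theorem profileRule_prob (hδ₀ : 0 < δ) (hδ₁ : δ < 1) (hR : 0 ≤ R) (hw : IsFeasible δ X x₀ R w)
    {t : ℕ} (h : History t) :
    (((profileRule δ w hw.mono).toRule.prob t h : unitInterval) : ℝ) = stopProb δ (w h.best) := by
  have := Set.projIcc_of_mem (zero_le_one (α := ℝ)) (x := stopProb δ (w h.best))
    ⟨stopProb_nonneg hδ₀ hδ₁ (hR.trans (hw.le_val _)) (hw.le_one _),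
      stopProb_le_one hδ₀ hδ₁ (hw.le_one _)⟩
  exact congrArg Subtype.val this

/-- A lower bound for the payoff of the rule with profile `w` in an environment with reservation
value `c`, as a function of the best-so-far alternative. -/
def payoffBound (R c : ℝ) (w : ℝ → ℝ) (x : ℝ) : ℝ := if x < c then R * c else x * w x

theorem measurable_payoffBound (c : ℝ) (hw : Monotone w) : Measurable (payoffBound R c w) :=
  Measurable.ite measurableSet_Iio measurable_const (measurable_id.mul hw.measurable)

theorem payoffBound_nonneg (hR : 0 ≤ R) {c : ℝ} (hc : 0 ≤ c) (hw : IsFeasible δ X x₀ R w)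
    {x : ℝ} (hx : 0 ≤ x) : 0 ≤ payoffBound R c w x := by
  unfold payoffBound
  split_ifs
  · positivity
  · exact mul_nonneg hx (hR.trans (hw.le_val x))

theorem payoffBound_le (hR₁ : R ≤ 1) {c : ℝ} (hc : 0 ≤ c) (hw : IsFeasible δ X x₀ R w)
    {x : ℝ} (hx : 0 ≤ x) : payoffBound R c w x ≤ max x c := by
  unfold payoffBound
  split_ifs
  · exact (mul_le_of_le_one_left hc hR₁).trans (le_max_right _ _)
  · exact (mul_le_of_le_one_right hx (hw.le_one x)).trans (le_max_left _ _)

theorem le_payoffBound {c : ℝ} (hw : IsFeasible δ X x₀ R w)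
    {x : ℝ} (hx : 0 ≤ x) : R * max x c ≤ payoffBound R c w x := by
  unfold payoffBound
  split_ifs with h
  · rw [max_eq_right h.le]
  · rw [max_eq_left (not_lt.1 h), mul_comm]
    exact mul_le_mul_of_nonneg_left (hw.le_val x) hx

variable {F : Measure ℝ} [IsProbabilityMeasure F]

theorem integrable_payoffBound (hR : 0 ≤ R) (hR₁ : R ≤ 1) {c : ℝ} (hc : 0 ≤ c)
    (hw : IsFeasible δ X x₀ R w) (hF : Integrable (fun x : ℝ => x) F) {y : ℝ} (hy : 0 ≤ y) :
    Integrable (fun x => payoffBound R c w (max y x)) F := by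
  refine Integrable.mono' ((integrable_max_const hF y).sup (integrable_const c))
    ((measurable_payoffBound c hw.mono).comp
      (measurable_const.max measurable_id)).aestronglyMeasurable (ae_of_all _ fun x => ?_)
  have hx : 0 ≤ max y x := hy.trans (le_max_left _ _)
  rw [Real.norm_of_nonneg (payoffBound_nonneg hR hc hw hx)]
  exact payoffBound_le hR₁ hc hw hx

/-- This is the binary condition with `σ = 1`, where the reservation value is `δ * x`. If `δ * x ≤
y` that condition is void, and `R ≤ w x` suffices. -/
theorem affine_le_payoffBound (hδ₀ : 0 < δ) (hδ₁ : δ < 1) (hR : 0 ≤ R) (hR₁ : R ≤ 1)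
    (hw : IsFeasible δ X x₀ R w) (hx₀ : 0 < x₀) {y : ℝ} (hy : x₀ ≤ y) {x : ℝ} (hx : x ∈ X)
    (hyx : y ≤ x) :
    R * δ * x * (1 - δ * w y) - (1 - δ) * w y * y ≤ (1 - w y) * δ * (x * w x) := by
  have hW₁ := hw.le_one y
  have hRx := hw.le_val x
  rcases le_or_gt (δ * x) y with h | h
  · have h1 : (1 - w y) * δ * (x * R) ≤ (1 - w y) * δ * (x * w x) := by
      have : 0 ≤ (1 - w y) * δ * x := mul_nonneg (mul_nonneg (by linarith) hδ₀.le) (by linarith)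
      nlinarith [mul_le_mul_of_nonneg_left hRx this]
    have h2 : 0 ≤ (1 - δ) * w y * (y - R * (δ * x)) := by
      refine mul_nonneg (mul_nonneg (by linarith) (hR.trans (hw.le_val y))) ?_
      have : R * (δ * x) ≤ 1 * (δ * x) :=
        mul_le_mul_of_nonneg_right hR₁ (mul_nonneg hδ₀.le (by linarith))
      linarith
    nlinarith
  · have := hw.binary_le y hy x hx 1 one_pos le_rfl (δ * x) (by ring) h
    nlinarith

/-- The bound is a subsolution of the payoff recursion. For `c ≤ y` this follows from monotonicity
of `w`; for `y < c` it is the reduction to binary environments. -/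
theorem payoffBound_le_step (hδ₀ : 0 < δ) (hδ₁ : δ < 1) (hR : 0 ≤ R) (hR₁ : R ≤ 1)
    (hx₀ : 0 < x₀) (hw : IsFeasible δ X x₀ R w) (hFX : ∀ᵐ x ∂F, x ∈ X)
    (hF : Integrable (fun x : ℝ => x) F) {c : ℝ} (hc : IsReservation δ F c)
    {y : ℝ} (hy : x₀ ≤ y) :
    payoffBound R c w y ≤ stopProb δ (w y) * y +
      (1 - stopProb δ (w y)) * (δ * ∫ x, payoffBound R c w (max y x) ∂F) := by
  have hy0 : 0 < y := hx₀.trans_le hy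
  have hW₁ := hw.le_one y
  have hW₀ : 0 ≤ w y := hR.trans (hw.le_val y)
  have hpos := one_sub_mul_pos hδ₀ hδ₁ hW₁
  have hs := stopProb_mul hδ₀ hδ₁ hW₁
  have hint := integrable_payoffBound hR hR₁ hc.nonneg hw hF hy0.le
  set I := ∫ x, payoffBound R c w (max y x) ∂F
  suffices hsuff : payoffBound R c w y * (1 - δ * w y) ≤
      (1 - δ) * w y * y + (1 - w y) * δ * I by
    refine le_of_mul_le_mul_right (hsuff.trans (le_of_eq ?_)) hpos
    linear_combination (δ * I - y) * hs
  rcases le_or_gt c y with hcy | hyc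
  · have h1 : y * w y ≤ I := by
      have : ∫ _, y * w y ∂F ≤ I := integral_mono (integrable_const _) hint fun x => by
        have h2 : c ≤ max y x := hcy.trans (le_max_left _ _)
        simp only [payoffBound, not_lt.2 h2, if_false]
        exact mul_le_mul (le_max_left _ _) (hw.mono (le_max_left _ _)) hW₀
          (hy0.le.trans (le_max_left _ _))
      simpa using this
    have h2 : 0 ≤ (1 - w y) * δ := mul_nonneg (by linarith) hδ₀.le
    simp only [payoffBound, not_lt.2 hcy, if_false]
    nlinarith [mul_le_mul_of_nonneg_left h1 h2]
  have hc0 : 0 < c := hy0.trans hyc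
  simp only [payoffBound, hyc, if_true]
  set E := ∫ x, max c x ∂F with hE
  have hcE : c = δ * E := hc.eq
  set W := w y with hW
  set P := R * c * (1 - δ * W) - (1 - δ) * W * y with hP
  suffices hPI : P ≤ (1 - W) * δ * I by linarith
  have hmaxc := integrable_max_const hF c
  have hval : ∀ x, c ≤ x → payoffBound R c w (max y x) = x * w x := fun x hx => by
    rw [max_eq_right (hyc.le.trans hx)]
    simp [payoffBound, not_lt.2 hx]
  have hval' : ∀ x, x < c → payoffBound R c w (max y x) = R * c := fun x hx => by
    simp [payoffBound, max_lt hyc hx]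
  have hI' : (1 - W) * δ * I = ∫ x, (1 - W) * δ * payoffBound R c w (max y x) ∂F := by
    rw [integral_const_mul]
  rw [hI']
  -- Both cases minorize the integrand by an affine function of `max c x` with mean `P`. If `y` is
  -- at least `δ * (R * c)`, the line from `affine_le_payoffBound` also works for `x < c`.
  rcases le_or_gt (δ * (R * c)) y with hcase | hcase
  · have hD : ∫ x, (R * δ * (1 - δ * W) * max c x - (1 - δ) * W * y) ∂F = P := by
      rw [integral_sub (hmaxc.const_mul _) (integrable_const _), integral_const_mul]
      simp only [integral_const, probReal_univ, smul_eq_mul, one_mul]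
      rw [← hE, hP, hcE]
      ring
    rw [← hD]
    refine integral_mono_ae ((hmaxc.const_mul _).sub (integrable_const _)) (hint.const_mul _) ?_
    filter_upwards [hFX] with x hxX
    rcases lt_or_ge x c with hx | hx
    · rw [hval' x hx, max_eq_left hx.le]
      have : 0 ≤ (1 - δ) * W * (y - δ * (R * c)) :=
        mul_nonneg (mul_nonneg (by linarith) hW₀) (by linarith)
      nlinarith
    · rw [hval x hx, max_eq_right hx]
      have := affine_le_payoffBound hδ₀ hδ₁ hR hR₁ hw hx₀ hy hxX (hyc.le.trans hx)
      linarith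
  -- Now that line may be too high below `c`. The line used instead takes the exact value `A` at
  -- `c`; its slope is set by the mean `P`, as `k` is the mean of `max c x - c`.
  · set A := (1 - W) * δ * (R * c) with hA
    set k := E - c with hk
    have hk0 : 0 < k := by nlinarith
    have hδk : δ * k = (1 - δ) * c := by rw [hk, mul_sub, ← hcE]; ring
    have hD : ∫ x, (A + (P - A) / k * (max c x - c)) ∂F = P := by
      have hi : Integrable (fun x => (P - A) / k * (max c x - c)) F :=
        (hmaxc.sub (integrable_const _)).const_mul _
      rw [integral_add (integrable_const _) hi, integral_const_mul ((P - A) / k),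
        integral_sub hmaxc (integrable_const _)]
      simp only [integral_const, probReal_univ, smul_eq_mul, one_mul]
      rw [← hE, ← hk, div_mul_cancel₀ _ hk0.ne']
      ring
    rw [← hD]
    refine integral_mono_ae ((integrable_const _).add
      ((hmaxc.sub (integrable_const _)).const_mul _)) (hint.const_mul _) ?_
    filter_upwards [hFX] with x hxX
    rcases lt_or_ge x c with hx | hx
    · rw [hval' x hx, max_eq_left hx.le]
      simp [hA]
    rw [hval x hx, max_eq_right hx]
    rcases le_or_gt k (x - c) with hkx | hkx
    · have hxc : 0 < x - c := hk0.trans_le hkx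
      -- With this probability of `x`, the binary environment has reservation value exactly `c`.
      set σ := k / (x - c) with hσ
      have hσx : σ * (x - c) = k := div_mul_cancel₀ _ hxc.ne'
      have hσ0 : 0 < σ := div_pos hk0 hxc
      have hσ1 : σ ≤ 1 := (div_le_one hxc).2 hkx
      have hb := hw.binary_le y hy x hxX σ hσ0 hσ1 c
        (by linear_combination (-δ) * hσx - hδk) hyc
      have h1 : P - A ≤ σ * ((1 - W) * δ * (x * w x) - A) := by
        rw [hP, hA]; linarith
      have h2 : (P - A) / k * (x - c) ≤ (1 - W) * δ * (x * w x) - A := by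
        rw [div_mul_eq_mul_div, div_le_iff₀ hk0, ← hσx]
        nlinarith [mul_le_mul_of_nonneg_right h1 hxc.le]
      linarith
    · have hT := affine_le_payoffBound hδ₀ hδ₁ hR hR₁ hw hx₀ hy hxX (hyc.le.trans hx)
      -- So near to `c`, the probability above would exceed one. The sure-arrival line is used
      -- again; it lies above the present one by the term in `hDA`.
      set s := (x - c) / k with hs'
      have hsk : s * k = x - c := div_mul_cancel₀ _ hk0.ne'
      have hs0 : 0 ≤ s := div_nonneg (by linarith) hk0.le
      have hs1 : s ≤ 1 := (div_le_one hk0).2 hkx.le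
      have hDA : 0 ≤ (1 - s) * ((1 - δ) * W * (δ * (R * c) - y)) :=
        mul_nonneg (by linarith) (mul_nonneg (mul_nonneg (by linarith) hW₀) (by linarith))
      have h3 : (P - A) / k * (x - c) = s * (P - A) := by rw [hs']; ring
      rw [h3]
      refine le_trans (le_of_sub_nonneg ?_) hT
      refine hDA.trans (le_of_eq ?_)
      rw [hP, hA, ← hW]
      linear_combination (- R * (1 - δ * W) * s) * hδk + R * δ * (1 - δ * W) * hsk

theorem IsFeasible.mul_optPayoff_le (hδ₀ : 0 < δ) (hδ₁ : δ < 1) (hR : 0 < R) (hR₁ : R ≤ 1)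
    (hx₀ : 0 < x₀) (hw : IsFeasible δ X x₀ R w) (hFX : ∀ᵐ x ∂F, x ∈ X)
    (hF : Integrable (fun x : ℝ => x) F) {t : ℕ} (h : History t) (hb : x₀ ≤ h.best) :
    ENNReal.ofReal R * optPayoff δ F h ≤ payoff δ (profileRule δ w hw.mono).toRule F h := by
  obtain ⟨c, hc⟩ := exists_isReservation hδ₀ hδ₁ hF
  -- As `w ≥ R`, the rule waits with probability at most `ρ < 1`, so the truncation error shrinks
  -- geometrically. This needs `R > 0`.
  set ρ := 1 - stopProb δ R with hρ
  have hρ0 : 0 ≤ ρ := by linarith [stopProb_le_one hδ₀ hδ₁ hR₁]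
  have hρ1 : ρ < 1 := by
    have : 0 < stopProb δ R :=
      div_pos (mul_pos (by linarith) hR) (one_sub_mul_pos hδ₀ hδ₁ hR₁)
    linarith
  have key : ∀ n : ℕ, ∀ {t : ℕ} (h : History t), x₀ ≤ h.best →
      ENNReal.ofReal (payoffBound R c w h.best - ρ ^ n * max h.best c) ≤
        payoffUpTo δ (profileRule δ w hw.mono).toRule F n h := by
    intro n
    induction n with
    | zero =>
      intro t h hb
      rw [ENNReal.ofReal_of_nonpos]
      · exact zero_le
      · have := payoffBound_le hR₁ hc.nonneg hw (hx₀.le.trans hb)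
        simpa using this
    | succ n ih =>
      intro t h hb
      have hb0 := hx₀.le.trans hb
      have hi1 := integrable_payoffBound hR.le hR₁ hc.nonneg hw hF hb0
      have hi2 : Integrable (fun x => max (max h.best x) c) F :=
        (integrable_max_const hF _).sup (integrable_const c)
      refine le_trans (ENNReal.ofReal_le_ofReal ?_) (le_payoffUpTo_succ
        (f := fun x => payoffBound R c w (max h.best x) - ρ ^ n * max (max h.best x) c)
        hδ₀.le n h (hi1.sub (hi2.const_mul _)) (ae_of_all _ fun x => ?_))
      · rw [profileRule_prob hδ₀ hδ₁ hR.le hw, integral_sub hi1 (hi2.const_mul _),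
          integral_const_mul]
        have h1 := payoffBound_le_step hδ₀ hδ₁ hR.le hR₁ hx₀ hw hFX hF hc hb
        have h2 := hc.integral_le hδ₀.le hδ₁.le hF h.best
        have h3 : 1 - stopProb δ (w h.best) ≤ ρ := by
          linarith [stopProb_mono hδ₀ hδ₁ (hw.le_val h.best) (hw.le_one _)]
        have h4 : 0 ≤ 1 - stopProb δ (w h.best) := by
          linarith [stopProb_le_one hδ₀ hδ₁ (hw.le_one h.best)]
        have h5 : 0 ≤ max h.best c := hb0.trans (le_max_left _ _)
        have h6 : (1 - stopProb δ (w h.best)) *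
            (ρ ^ n * (δ * ∫ x, max (max h.best x) c ∂F)) ≤ ρ * (ρ ^ n * max h.best c) :=
          (mul_le_mul_of_nonneg_left (mul_le_mul_of_nonneg_left h2 (pow_nonneg hρ0 n)) h4).trans
            (mul_le_mul_of_nonneg_right h3 (mul_nonneg (pow_nonneg hρ0 n) h5))
        rw [pow_succ']
        nlinarith
      · rw [← History.best_append]
        exact ih _ (by rw [History.best_append]; exact hb.trans (le_max_left _ _))
  have hlim : Filter.Tendsto
      (fun n : ℕ => ENNReal.ofReal (payoffBound R c w h.best - ρ ^ n * max h.best c))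
      Filter.atTop (nhds (ENNReal.ofReal (payoffBound R c w h.best - 0 * max h.best c))) :=
    (ENNReal.continuous_ofReal.tendsto _).comp
      (((tendsto_pow_atTop_nhds_zero_of_lt_one hρ0 hρ1).mul_const _).const_sub _)
  rw [zero_mul, sub_zero] at hlim
  rw [hc.optPayoff_eq hδ₀.le hδ₁ hF h (hx₀.le.trans hb), ← ENNReal.ofReal_mul hR.le]
  exact (ENNReal.ofReal_le_ofReal (le_payoffBound hw (hx₀.le.trans hb))).trans
    (le_of_tendsto' hlim fun n => (key n h hb).trans (payoffUpTo_le_payoff _ h))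

end Feasible

/-! ### The profile of a history-dependent rule -/

/-- The atomic environment `F` is consistent with the history `h` and never improves on it. -/
structure IsConfined (X : Set ℝ) (x₀ : ℝ) {t : ℕ} (h : History t) (F : Measure ℝ) : Prop where
  prob : IsProbabilityMeasure F
  mem : h ∈ histories X x₀ t
  ae_mem : ∀ᵐ x ∂F, x ∈ X
  ae_le : ∀ᵐ x ∂F, x ≤ h.best
  ae_atom : ∀ᵐ x ∂F, F {x} ≠ 0
  likelihood_ne : likelihood F h ≠ 0

/-- The lottery that yields `z` with probability `σ` and is drawn from `F` otherwise. -/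
def mixture (F : Measure ℝ) (z σ : ℝ) : Measure ℝ :=
  ENNReal.ofReal (1 - σ) • F + ENNReal.ofReal σ • Measure.dirac z

section Mixture

variable {F : Measure ℝ} {z σ : ℝ}

theorem isProbabilityMeasure_mixture [IsProbabilityMeasure F] (hσ₀ : 0 ≤ σ) (hσ₁ : σ ≤ 1) :
    IsProbabilityMeasure (mixture F z σ) :=
  ⟨by simp [mixture, ← ENNReal.ofReal_add (sub_nonneg.2 hσ₁) hσ₀]⟩

theorem ae_mixture {P : ℝ → Prop} (hF : ∀ᵐ x ∂F, P x) (hz : P z) : ∀ᵐ x ∂mixture F z σ, P x := by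
  rw [mixture, ae_add_measure_iff]
  refine ⟨Measure.ae_smul_measure hF _, Measure.ae_smul_measure ?_ _⟩
  rw [ae_dirac_eq]
  exact hz

theorem integral_mixture (hσ₀ : 0 ≤ σ) (hσ₁ : σ ≤ 1) {f : ℝ → ℝ} (hf : Integrable f F) :
    ∫ x, f x ∂mixture F z σ = (1 - σ) * ∫ x, f x ∂F + σ * f z := by
  have hz : Integrable f (Measure.dirac z) := integrable_dirac (by simp)
  rw [mixture, integral_add_measure (hf.smul_measure ENNReal.ofReal_ne_top)
    (hz.smul_measure ENNReal.ofReal_ne_top), integral_smul_measure, integral_smul_measure,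
    integral_dirac, ENNReal.toReal_ofReal (by linarith), ENNReal.toReal_ofReal hσ₀]
  simp

theorem mixture_singleton_ne (hσ₁ : σ < 1) {x : ℝ} (hx : F {x} ≠ 0) : mixture F z σ {x} ≠ 0 := by
  simp [mixture, hx, hσ₁]

theorem mixture_singleton_self_ne (hσ₀ : 0 < σ) : mixture F z σ {z} ≠ 0 := by
  simp [mixture, hσ₀]

theorem likelihood_mixture_ne (hσ₁ : σ < 1) {t : ℕ} {h : History t} (hh : likelihood F h ≠ 0) :
    likelihood (mixture F z σ) h ≠ 0 := by
  rw [likelihood, Finset.prod_ne_zero_iff] at hh ⊢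
  exact fun i hi => mixture_singleton_ne hσ₁ (hh i hi)

end Mixture

theorem integrable_of_ae_mem_Icc {F : Measure ℝ} [IsProbabilityMeasure F] {b : ℝ}
    (h₀ : ∀ᵐ x ∂F, 0 ≤ x) (hb : ∀ᵐ x ∂F, x ≤ b) : Integrable (fun x : ℝ => x) F := by
  refine Integrable.mono' (integrable_const b) measurable_id.aestronglyMeasurable ?_
  filter_upwards [h₀, hb] with x h1 h2
  rwa [Real.norm_of_nonneg h1]

theorem mem_environments {X : Set ℝ} (hXnonneg : ∀ x ∈ X, 0 ≤ x) {F : Measure ℝ}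
    [hp : IsProbabilityMeasure F] (hF : ∀ᵐ x ∂F, x ∈ X) {b : ℝ} (hb : ∀ᵐ x ∂F, x ≤ b) :
    F ∈ environments X :=
  ⟨hp, mem_ae_iff.1 hF, integrable_of_ae_mem_Icc (hF.mono hXnonneg) hb⟩

section Confined

variable {X : Set ℝ} {x₀ : ℝ} {t : ℕ} {h : History t} {F : Measure ℝ}

/-- Atomicity is what keeps the history consistent after almost every draw. -/
theorem IsConfined.append (hF : IsConfined X x₀ h F) :
    ∀ᵐ x ∂F, IsConfined X x₀ (h.append x) F ∧ (h.append x).best = h.best := by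
  filter_upwards [hF.ae_mem, hF.ae_le, hF.ae_atom] with x h1 h2 h3
  have hb : (h.append x).best = h.best := by rw [History.best_append, max_eq_left h2]
  exact ⟨⟨hF.prob, History.append_mem hF.mem h1, hF.ae_mem, by rw [hb]; exact hF.ae_le,
    hF.ae_atom, by rw [likelihood_append]; exact mul_ne_zero hF.likelihood_ne h3⟩, hb⟩

theorem IsConfined.mixture (hF : IsConfined X x₀ h F) {z σ : ℝ} (hz : z ∈ X) (hb : h.best ≤ z)
    (hσ₀ : 0 < σ) (hσ₁ : σ < 1) :
    IsConfined X x₀ (h.append z) (mixture F z σ) ∧ (h.append z).best = z := by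
  have hb' : (h.append z).best = z := by rw [History.best_append, max_eq_right hb]
  have := hF.prob
  refine ⟨⟨isProbabilityMeasure_mixture hσ₀.le hσ₁.le, History.append_mem hF.mem hz,
    ae_mixture hF.ae_mem hz, ?_, ?_, ?_⟩, hb'⟩
  · rw [hb']
    exact ae_mixture (hF.ae_le.mono fun x hx => hx.trans hb) le_rfl
  · exact ae_mixture (hF.ae_atom.mono fun x hx => mixture_singleton_ne hσ₁ hx)
      (mixture_singleton_self_ne hσ₀)
  · rw [likelihood_append]
    exact mul_ne_zero (likelihood_mixture_ne hσ₁ hF.likelihood_ne) (mixture_singleton_self_ne hσ₀)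

theorem isConfined_const (hX₀ : (0 : ℝ) ∈ X) (hx₀ : 0 ≤ x₀) :
    IsConfined X x₀ (fun _ : Fin 1 => x₀ : History 0) (Measure.dirac 0) where
  prob := inferInstance
  mem := ⟨rfl, fun i => i.elim0⟩
  ae_mem := by rw [ae_dirac_eq]; exact hX₀
  ae_le := by rw [ae_dirac_eq, History.best_const]; exact hx₀
  ae_atom := by rw [ae_dirac_eq]; simp
  likelihood_ne := by simp [likelihood]

end Confined

/-- The payoffs of the rule `p`, relative to the best-so-far alternative, in environments that
never improve on it. -/
def relativePayoffs (δ : ℝ) (X : Set ℝ) (x₀ : ℝ) (p : DecisionRule) (y : ℝ) : Set ℝ :=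
  -- Allowing every best up to `y` makes the supremum monotone; the maximum with `x₀` keeps the set
  -- nonempty for small `y`.
  {r | ∃ (t : ℕ) (h : History t) (F : Measure ℝ), IsConfined X x₀ h F ∧ h.best ≤ max y x₀ ∧
    r = (payoff δ p F h).toReal / h.best}

/-- The profile of a rule. -/
def ruleProfile (δ : ℝ) (X : Set ℝ) (x₀ : ℝ) (p : DecisionRule) (y : ℝ) : ℝ :=
  sSup (relativePayoffs δ X x₀ p y)

/-! ### Feasibility of the profile of a rule -/

section RuleProfile

variable {δ x₀ R : ℝ} {X : Set ℝ} {p : DecisionRule}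

theorem toReal_payoff_le {F : Measure ℝ} [IsProbabilityMeasure F] (hδ₀ : 0 < δ) (hδ₁ : δ < 1)
    {b : ℝ} (hF : ∀ᵐ x ∂F, x ≤ b) {t : ℕ} (h : History t) (hb₀ : 0 ≤ h.best) (hb : h.best ≤ b) :
    (payoff δ p F h).toReal ≤ b :=
  ENNReal.toReal_le_of_le_ofReal (hb₀.trans hb) (payoff_le_of_ae_le hδ₀.le hδ₁.le hF h hb₀ hb)

theorem toReal_payoff_le_succ {F : Measure ℝ} [IsProbabilityMeasure F] (hδ₀ : 0 < δ) (hδ₁ : δ < 1)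
    {b : ℝ} (hF : ∀ᵐ x ∂F, x ≤ b) {t : ℕ} (h : History t) (hb₀ : 0 ≤ h.best) (hb : h.best ≤ b) :
    Integrable (fun x => (payoff δ p F (h.append x)).toReal) F ∧
    (payoff δ p F h).toReal ≤ p.prob t h * h.best +
      (1 - p.prob t h) * (δ * ∫ x, (payoff δ p F (h.append x)).toReal ∂F) := by
  have hfin : ∀ᵐ x ∂F, payoff δ p F (h.append x) ≤ ENNReal.ofReal b := by
    filter_upwards [hF] with x hx
    exact payoff_le_of_ae_le hδ₀.le hδ₁.le hF _
      (by rw [History.best_append]; exact hb₀.trans (le_max_left _ _))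
      (by rw [History.best_append]; exact max_le hb hx)
  have hint : Integrable (fun x => (payoff δ p F (h.append x)).toReal) F := by
    refine Integrable.mono' (integrable_const b)
      (measurable_payoff_append h).ennreal_toReal.aestronglyMeasurable ?_
    filter_upwards [hfin] with x hx
    rw [Real.norm_of_nonneg ENNReal.toReal_nonneg]
    exact ENNReal.toReal_le_of_le_ofReal (hb₀.trans hb) hx
  refine ⟨hint, ENNReal.toReal_le_of_le_ofReal ?_ (payoff_le_succ hδ₀.le h hb₀ hint
    (ae_of_all _ fun x => ENNReal.toReal_nonneg) ?_)⟩
  · have h0 := prob_nonneg p h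
    have h1 := prob_le_one p h
    have h2 : 0 ≤ ∫ x, (payoff δ p F (h.append x)).toReal ∂F :=
      integral_nonneg fun x => ENNReal.toReal_nonneg
    exact add_nonneg (mul_nonneg h0 hb₀) (mul_nonneg (by linarith) (mul_nonneg hδ₀.le h2))
  · filter_upwards [hfin] with x hx
    rw [ENNReal.ofReal_toReal (ne_top_of_le_ne_top ENNReal.ofReal_ne_top hx)]

theorem relativePayoff_le_one (hδ₀ : 0 < δ) (hδ₁ : δ < 1) (hx₀ : 0 < x₀) {t : ℕ} {h : History t}
    {F : Measure ℝ} (hF : IsConfined X x₀ h F) : (payoff δ p F h).toReal / h.best ≤ 1 := by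
  have := hF.prob
  have hb := hx₀.trans_le (History.le_best_of_mem hF.mem)
  rw [div_le_one hb]
  exact toReal_payoff_le hδ₀ hδ₁ hF.ae_le h hb.le le_rfl

theorem bddAbove_relativePayoffs (hδ₀ : 0 < δ) (hδ₁ : δ < 1) (hx₀ : 0 < x₀) (y : ℝ) :
    BddAbove (relativePayoffs δ X x₀ p y) := by
  refine ⟨1, ?_⟩
  rintro r ⟨t, h, F, hF, -, rfl⟩
  exact relativePayoff_le_one hδ₀ hδ₁ hx₀ hF

theorem nonempty_relativePayoffs (hX₀ : (0 : ℝ) ∈ X) (hx₀ : 0 < x₀) (y : ℝ) :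
    (relativePayoffs δ X x₀ p y).Nonempty :=
  ⟨_, 0, _, _, isConfined_const hX₀ hx₀.le, by rw [History.best_const]; exact le_max_right _ _, rfl⟩

theorem le_ruleProfile (hδ₀ : 0 < δ) (hδ₁ : δ < 1) (hx₀ : 0 < x₀) {t : ℕ} {h : History t}
    {F : Measure ℝ} (hF : IsConfined X x₀ h F) {y : ℝ} (hy : h.best ≤ y) :
    (payoff δ p F h).toReal / h.best ≤ ruleProfile δ X x₀ p y :=
  le_csSup (bddAbove_relativePayoffs hδ₀ hδ₁ hx₀ y)
    ⟨t, h, F, hF, hy.trans (le_max_left _ _), rfl⟩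

/-- If the guaranteed fraction `R` were incompatible with the profile in the binary environment
`(z, σ)`, then all relative payoffs at histories with a best-so-far alternative of at most `y`
would fall short of the profile by a fixed amount. -/
theorem ruleProfile_binary_le (hδ₀ : 0 < δ) (hδ₁ : δ < 1) (hR : 0 < R)
    (hXnonneg : ∀ x ∈ X, 0 ≤ x) (hX₀ : (0 : ℝ) ∈ X) (hx₀ : 0 < x₀)
    (H : ∀ F ∈ environments X, ∀ (t : ℕ) (h : History t), h ∈ histories X x₀ t →
      likelihood F h ≠ 0 → ENNReal.ofReal R * optPayoff δ F h ≤ payoff δ p F h)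
    (hRW : ∀ y, R ≤ ruleProfile δ X x₀ p y) (hW₁ : ∀ y, ruleProfile δ X x₀ p y ≤ 1)
    {y : ℝ} (hy : x₀ ≤ y) {z : ℝ} (hz : z ∈ X) {σ : ℝ} (hσ₀ : 0 < σ) (hσ₁ : σ < 1) {c : ℝ}
    (hc : c * (1 - δ + δ * σ) = δ * σ * z) (hyc : y < c) :
    R * c * (1 - δ * ruleProfile δ X x₀ p y) ≤
      (1 - δ) * ruleProfile δ X x₀ p y * y + (1 - ruleProfile δ X x₀ p y) *
        (δ * (1 - σ) * (R * c) + δ * σ * (z * ruleProfile δ X x₀ p z)) := by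
  set W := ruleProfile δ X x₀ p y with hW
  set Wz := ruleProfile δ X x₀ p z with hWz
  by_contra! hN
  have hWR := hRW y
  have hW1 := hW₁ y
  have hWzR := hRW z
  have hy0 : 0 < y := hx₀.trans_le hy
  have hc0 : 0 < c := hy0.trans hyc
  have hcz : c ≤ z := by
    have : 0 < δ * σ := mul_pos hδ₀ hσ₀
    by_contra! hcz
    nlinarith [mul_pos hc0 (sub_pos.2 hδ₁)]
  have hz0 : 0 < z := hc0.trans_le hcz
  set M := δ * σ * (z * Wz) with hM
  have hδσ : 0 < δ * σ := mul_pos hδ₀ hσ₀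
  have hMR : R * c * (1 - δ + δ * σ) ≤ M := by
    have : δ * σ * (z * R) ≤ M := by rw [hM]; gcongr
    calc R * c * (1 - δ + δ * σ) = δ * σ * (z * R) := by linear_combination R * hc
      _ ≤ M := this
  -- Otherwise stopping alone already secures `R * c`, and the inequality holds.
  have hyR : y < R * c := by
    by_contra! h
    have h1 : (1 - δ) * W * (R * c) ≤ (1 - δ) * W * y :=
      mul_le_mul_of_nonneg_left h (mul_nonneg (by linarith) (hR.le.trans hWR))
    have h2 := mul_le_mul_of_nonneg_left hMR (sub_nonneg.2 hW1)
    nlinarith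
  set d := R * c - y with hd
  have hd0 : 0 < d := sub_pos.2 hyR
  -- The weight of the mixture payoff against the relative payoff in `F`. It is chosen so that `K`,
  -- the bound on the weighted value of stopping, equals `W + l * (R * c)`.
  set l := (1 - W) / d with hl
  have hld : l * d = 1 - W := div_mul_cancel₀ _ hd0.ne'
  have hl0 : 0 ≤ l := div_nonneg (by linarith) hd0.le
  set K := 1 + l * y with hK
  -- The loss from waiting: `η * d` is the amount by which the inequality is assumed to fail.
  set η := (1 - δ) * K - l * M + l * (δ * σ) * (R * c) with hη
  have hη0 : 0 < η := by
    have : η * d = R * c * (1 - δ * W) -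
        ((1 - δ) * W * y + (1 - W) * (δ * (1 - σ) * (R * c) + M)) := by
      rw [hη, hK]
      linear_combination ((1 - δ) * y - M + δ * σ * (R * c)) * hld + (1 - δ) * hd
    exact pos_of_mul_pos_left (by rw [this]; linarith) hd0.le
  -- the environment in which `z` is found with probability `σ`
  have hprep : ∀ {t : ℕ} {h : History t} {F : Measure ℝ}, IsConfined X x₀ h F → h.best ≤ y →
      R * c ≤ (payoff δ p (mixture F z σ) h).toReal ∧
      (payoff δ p (mixture F z σ) h).toReal ≤ z := by
    intro t h F hF hb
    have := hF.prob
    have hpm : IsProbabilityMeasure (mixture F z σ) := isProbabilityMeasure_mixture hσ₀.le hσ₁.le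
    have hbz : ∀ᵐ x ∂mixture F z σ, x ≤ z :=
      ae_mixture (hF.ae_le.mono fun x hx => hx.trans (hb.trans (hyc.le.trans hcz))) le_rfl
    have hmem : mixture F z σ ∈ environments X :=
      mem_environments hXnonneg (ae_mixture hF.ae_mem hz) hbz
    have hb0 : 0 ≤ h.best := hx₀.le.trans (History.le_best_of_mem hF.mem)
    have hres : IsReservation δ (mixture F z σ) c := by
      refine ⟨hc0.le, ?_⟩
      have hFi := integrable_of_ae_mem_Icc (hF.ae_mem.mono hXnonneg) hF.ae_le
      rw [integral_mixture hσ₀.le hσ₁.le (integrable_max_const hFi c), max_eq_right hcz,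
        integral_congr_ae (g := fun _ => c)
          (hF.ae_le.mono fun x hx => max_eq_left (hx.trans (hb.trans hyc.le)))]
      simp only [integral_const, probReal_univ, smul_eq_mul, one_mul]
      linear_combination hc
    have h1 := H _ hmem t h hF.mem (likelihood_mixture_ne hσ₁ hF.likelihood_ne)
    rw [hres.optPayoff_eq hδ₀.le hδ₁ hmem.2.2 h hb0, max_eq_right (hb.trans hyc.le),
      ← ENNReal.ofReal_mul hR.le] at h1
    have hle : payoff δ p (mixture F z σ) h ≤ ENNReal.ofReal z :=
      payoff_le_of_ae_le hδ₀.le hδ₁.le hbz h hb0 (hb.trans (hyc.le.trans hcz))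
    exact ⟨(ENNReal.ofReal_le_iff_le_toReal
      (ne_top_of_le_ne_top ENNReal.ofReal_ne_top hle)).1 h1,
      ENNReal.toReal_le_of_le_ofReal hz0.le hle⟩
  set S : Set ℝ := {r | ∃ (t : ℕ) (h : History t) (F : Measure ℝ), IsConfined X x₀ h F ∧
    h.best ≤ y ∧ r = (payoff δ p F h).toReal / h.best +
      l * (payoff δ p (mixture F z σ) h).toReal} with hS
  have hSb : BddAbove S := by
    refine ⟨1 + l * z, ?_⟩
    rintro r ⟨t, h, F, hF, hb, rfl⟩
    have h1 := relativePayoff_le_one (p := p) hδ₀ hδ₁ hx₀ hF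
    have h2 := mul_le_mul_of_nonneg_left (hprep hF hb).2 hl0
    linarith
  have hxb : History.best (fun _ : Fin 1 => x₀ : History 0) ≤ y := by
    rw [History.best_const]; exact hy
  have hSn : S.Nonempty := ⟨_, 0, _, _, isConfined_const hX₀ hx₀.le, hxb, rfl⟩
  -- The first bound expands one decision of the weighted payoff, using the profile at `z` once `z`
  -- arrives. The second holds because earning `R * c > y` in the mixture requires waiting with
  -- probability at least `d / z`.
  have hstep : ∀ {t : ℕ} {h : History t} {F : Measure ℝ}, IsConfined X x₀ h F → h.best ≤ y →
      (payoff δ p F h).toReal / h.best + l * (payoff δ p (mixture F z σ) h).toReal ≤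
        p.prob t h * K + (1 - p.prob t h) * (δ * sSup S + (1 - δ) * K - η) ∧
      d ≤ (1 - p.prob t h) * z := by
    intro t h F hF hb
    have := hF.prob
    have hpm : IsProbabilityMeasure (mixture F z σ) := isProbabilityMeasure_mixture hσ₀.le hσ₁.le
    have hb0 : 0 < h.best := hx₀.trans_le (History.le_best_of_mem hF.mem)
    have hbz : h.best ≤ z := hb.trans (hyc.le.trans hcz)
    have hmz : ∀ᵐ x ∂mixture F z σ, x ≤ z :=
      ae_mixture (hF.ae_le.mono fun x hx => hx.trans hbz) le_rfl
    have hq0 := prob_nonneg p h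
    have hq1 := prob_le_one p h
    set q : ℝ := ((p.prob t h : unitInterval) : ℝ)
    obtain ⟨hi1, hw⟩ := toReal_payoff_le_succ (p := p) hδ₀ hδ₁ hF.ae_le h hb0.le le_rfl
    obtain ⟨hi2, hu⟩ := toReal_payoff_le_succ (p := p) hδ₀ hδ₁ hmz h hb0.le hbz
    have hi2F : Integrable (fun x => (payoff δ p (mixture F z σ) (h.append x)).toReal) F := by
      have hle : ENNReal.ofReal (1 - σ) • F ≤ mixture F z σ := Measure.le_add_right le_rfl
      exact (integrable_smul_measure (by simpa using hσ₁) ENNReal.ofReal_ne_top).1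
        (hi2.mono_measure hle)
    rw [integral_mixture hσ₀.le hσ₁.le hi2F] at hu
    set Ew := ∫ x, (payoff δ p F (h.append x)).toReal ∂F with hEw
    set Eu := ∫ x, (payoff δ p (mixture F z σ) (h.append x)).toReal ∂F with hEu
    have huz : (payoff δ p (mixture F z σ) (h.append z)).toReal ≤ z * Wz := by
      obtain ⟨h1, h2⟩ := hF.mixture hz hbz hσ₀ hσ₁
      have h3 := le_ruleProfile (p := p) hδ₀ hδ₁ hx₀ h1 h2.le
      rw [h2, div_le_iff₀ hz0] at h3
      linarith
    have hsum : Ew / h.best + l * Eu ≤ sSup S := by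
      have : ∫ x, ((payoff δ p F (h.append x)).toReal / h.best +
          l * (payoff δ p (mixture F z σ) (h.append x)).toReal) ∂F ≤ ∫ _, sSup S ∂F := by
        refine integral_mono_ae ((hi1.div_const _).add (hi2F.const_mul l)) (integrable_const _) ?_
        filter_upwards [hF.append] with x hx
        refine le_csSup hSb ⟨t + 1, h.append x, F, hx.1, hx.2.trans_le hb, ?_⟩
        rw [hx.2]
      rw [integral_add (hi1.div_const _) (hi2F.const_mul l), integral_div, integral_const_mul] at this
      simpa using this
    have hEuR : R * c ≤ Eu := by
      have : ∫ _, R * c ∂F ≤ Eu := integral_mono_ae (integrable_const _) hi2F <| by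
        filter_upwards [hF.append] with x hx
        exact (hprep hx.1 (hx.2.trans_le hb)).1
      simpa using this
    have hEuz : Eu ≤ z := by
      have : Eu ≤ ∫ _, z ∂F := integral_mono_ae hi2F (integrable_const _) <| by
        filter_upwards [hF.append] with x hx
        exact (hprep hx.1 (hx.2.trans_le hb)).2
      simpa using this
    set u := (payoff δ p (mixture F z σ) h).toReal
    set uz := (payoff δ p (mixture F z σ) (h.append z)).toReal
    have huy : u ≤ q * y + (1 - q) * (δ * (1 - σ) * Eu + M) := by
      have h1 : q * h.best ≤ q * y := mul_le_mul_of_nonneg_left hb hq0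
      have h2 : (1 - q) * (δ * σ * uz) ≤ (1 - q) * M :=
        mul_le_mul_of_nonneg_left (mul_le_mul_of_nonneg_left huz hδσ.le) (by linarith)
      linarith
    constructor
    · have hw' : (payoff δ p F h).toReal / h.best ≤ q + (1 - q) * (δ * (Ew / h.best)) := by
        rw [div_le_iff₀ hb0]
        refine hw.trans (le_of_eq ?_)
        change q * h.best + (1 - q) * (δ * Ew) = _
        field_simp
      have h1 := mul_le_mul_of_nonneg_left huy hl0
      have h2 : l * (δ * σ) * (R * c) ≤ l * (δ * σ) * Eu :=
        mul_le_mul_of_nonneg_left hEuR (mul_nonneg hl0 hδσ.le)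
      have h3 := mul_le_mul_of_nonneg_left hsum hδ₀.le
      have h4 : δ * (Ew / h.best) + l * (δ * (1 - σ) * Eu + M) ≤
          δ * sSup S + (1 - δ) * K - η := by
        rw [hη]; linarith
      have h5 := mul_le_mul_of_nonneg_left h4 (sub_nonneg.2 hq1)
      rw [hK]
      linarith
    · have h1 : R * c ≤ u := (hprep hF hb).1
      have hMz : M ≤ δ * σ * z :=
        mul_le_mul_of_nonneg_left (mul_le_of_le_one_right hz0.le (hW₁ z)) hδσ.le
      have h2 : δ * (1 - σ) * Eu + M ≤ z := by
        have : δ * (1 - σ) * Eu ≤ δ * (1 - σ) * z :=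
          mul_le_mul_of_nonneg_left hEuz (mul_nonneg hδ₀.le (by linarith))
        have : δ * z ≤ z := mul_le_of_le_one_left hz0.le hδ₁.le
        linarith
      have h3 := mul_le_mul_of_nonneg_left h2 (sub_nonneg.2 hq1)
      have h4 : 0 ≤ (1 - q) * y := mul_nonneg (by linarith) hy0.le
      rw [hd]
      linarith
  have hSK : sSup S ≤ K := by
    by_contra! hcon
    have : sSup S ≤ δ * sSup S + (1 - δ) * K := by
      refine csSup_le hSn ?_
      rintro r ⟨t, h, F, hF, hb, rfl⟩
      have hq0 := prob_nonneg p h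
      have hq1 := prob_le_one p h
      have h1 := (hstep hF hb).1
      have h2 : 0 ≤ (p.prob t h : ℝ) * (δ * (sSup S - K)) :=
        mul_nonneg hq0 (mul_nonneg hδ₀.le (by linarith))
      have h3 : 0 ≤ (1 - (p.prob t h : ℝ)) * η := mul_nonneg (by linarith) hη0.le
      linarith
    nlinarith
  -- Subtracting the guaranteed `l * (R * c)` from the weighted payoff bounds every relative payoff
  -- by `W` minus a fixed amount, so their supremum cannot be `W`.
  have hfinal : W ≤ W - d / z * η := by
    rw [hW]
    refine csSup_le (nonempty_relativePayoffs hX₀ hx₀ y) ?_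
    rintro r ⟨t, h, F, hF, hb, rfl⟩
    rw [max_eq_left hy] at hb
    rw [← hW]
    have hq1 := prob_le_one p h
    obtain ⟨h1, h2⟩ := hstep hF hb
    have h3 : d / z ≤ 1 - (p.prob t h : ℝ) := (div_le_iff₀ hz0).2 h2
    have h4 := mul_le_mul_of_nonneg_right h3 hη0.le
    have h5 := mul_le_mul_of_nonneg_left (hprep hF hb).1 hl0
    have h6 := mul_le_mul_of_nonneg_left (mul_le_mul_of_nonneg_left hSK hδ₀.le)
      (sub_nonneg.2 hq1)
    have h7 : K - l * (R * c) = W := by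
      rw [hK]; linear_combination -hld - l * hd
    linarith
  have := mul_pos (div_pos hd0 hz0) hη0
  linarith

theorem isFeasible_ruleProfile (hδ₀ : 0 < δ) (hδ₁ : δ < 1) (hR : 0 < R)
    (hXnonneg : ∀ x ∈ X, 0 ≤ x) (hX₀ : (0 : ℝ) ∈ X) (hx₀ : 0 < x₀)
    (H : ∀ F ∈ environments X, ∀ (t : ℕ) (h : History t), h ∈ histories X x₀ t →
      likelihood F h ≠ 0 → ENNReal.ofReal R * optPayoff δ F h ≤ payoff δ p F h) :
    IsFeasible δ X x₀ R (ruleProfile δ X x₀ p) := by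
  have hW₁ : ∀ y, ruleProfile δ X x₀ p y ≤ 1 := fun y =>
    csSup_le (nonempty_relativePayoffs hX₀ hx₀ y) <| by
      rintro r ⟨t, h, F, hF, -, rfl⟩
      exact relativePayoff_le_one hδ₀ hδ₁ hx₀ hF
  have hRW : ∀ y, R ≤ ruleProfile δ X x₀ p y := fun y => by
    have hF := isConfined_const hX₀ hx₀.le
    have hb := History.best_const x₀
    set h : History 0 := fun _ : Fin 1 => x₀
    refine le_trans ?_ (le_csSup (bddAbove_relativePayoffs hδ₀ hδ₁ hx₀ y)
      ⟨0, h, _, hF, by rw [hb]; exact le_max_right _ _, rfl⟩)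
    have hmem := mem_environments hXnonneg hF.ae_mem hF.ae_le
    have h1 := H _ hmem 0 h hF.mem hF.likelihood_ne
    obtain ⟨c, hc⟩ := exists_isReservation hδ₀ hδ₁ hmem.2.2
    rw [hc.optPayoff_eq hδ₀.le hδ₁ hmem.2.2 h (hb ▸ hx₀.le), ← ENNReal.ofReal_mul hR.le] at h1
    have h2 : payoff δ p (Measure.dirac 0) h ≠ ⊤ := ne_top_of_le_ne_top ENNReal.ofReal_ne_top
      (payoff_le_of_ae_le hδ₀.le hδ₁.le hF.ae_le h (hb ▸ hx₀.le) le_rfl)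
    rw [le_div_iff₀ (hb ▸ hx₀)]
    refine le_trans ?_ ((ENNReal.ofReal_le_iff_le_toReal h2).1 h1)
    exact mul_le_mul_of_nonneg_left (le_max_left _ _) hR.le
  refine ⟨fun y y' hyy' => ?_, hRW, hW₁, ?_⟩
  · refine csSup_le_csSup (bddAbove_relativePayoffs hδ₀ hδ₁ hx₀ y')
      (nonempty_relativePayoffs hX₀ hx₀ y) ?_
    rintro r ⟨t, h, F, hF, hb, rfl⟩
    exact ⟨t, h, F, hF, hb.trans (max_le_max_right _ hyy'), rfl⟩
  · intro y hy z hz σ hσ₀ hσ₁ c hc hyc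
    -- With `σ = 1` the mixture may be inconsistent with the history, so this case is a limit from
    -- below.
    rcases hσ₁.lt_or_eq with hσ | rfl
    · exact ruleProfile_binary_le hδ₀ hδ₁ hR hXnonneg hX₀ hx₀ H hRW hW₁ hy hz hσ₀ hσ hc hyc
    set W := ruleProfile δ X x₀ p y
    set Wz := ruleProfile δ X x₀ p z
    let C : ℝ → ℝ := fun s => δ * s * z / (1 - δ + δ * s)
    have hC1 : C 1 = c := by
      have : c = δ * z := by linear_combination hc
      simp [C, this]
    have hCc : ContinuousAt C 1 := by
      refine ContinuousAt.div (by fun_prop) (by fun_prop) (by norm_num)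
    have hlim : ∀ᶠ s in nhdsWithin (1 : ℝ) (Iio 1), R * C s * (1 - δ * W) ≤
        (1 - δ) * W * y + (1 - W) * (δ * (1 - s) * (R * C s) + δ * s * (z * Wz)) := by
      have e1 : ∀ᶠ s in nhdsWithin (1 : ℝ) (Iio 1), y < C s :=
        (hCc.eventually (lt_mem_nhds (by rw [hC1]; exact hyc))).filter_mono nhdsWithin_le_nhds
      have e2 : ∀ᶠ s in nhdsWithin (1 : ℝ) (Iio 1), (0 : ℝ) < s :=
        (lt_mem_nhds one_pos).filter_mono nhdsWithin_le_nhds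
      filter_upwards [e1, e2, self_mem_nhdsWithin] with s h1 h2 h3
      refine ruleProfile_binary_le hδ₀ hδ₁ hR hXnonneg hX₀ hx₀ H hRW hW₁ hy hz h2 h3
        (div_mul_cancel₀ _ ?_) h1
      nlinarith [mul_pos hδ₀ h2]
    have hl : ContinuousAt (fun s => R * C s * (1 - δ * W)) 1 := by fun_prop
    have hr : ContinuousAt (fun s => (1 - δ) * W * y +
        (1 - W) * (δ * (1 - s) * (R * C s) + δ * s * (z * Wz))) 1 := by fun_prop
    have := le_of_tendsto_of_tendsto (hl.tendsto.mono_left nhdsWithin_le_nhds)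
      (hr.tendsto.mono_left nhdsWithin_le_nhds) hlim
    simpa only [hC1] using this

end RuleProfile

/-! ### Binary environments -/

theorem payoffUpTo_toRule_congr {δ : ℝ} {q : StationaryRule} {F : Measure ℝ} (n : ℕ) {s t : ℕ}
    {h : History s} {h' : History t} (hb : h.best = h'.best) :
    payoffUpTo δ q.toRule F n h = payoffUpTo δ q.toRule F n h' := by
  induction n generalizing s t with
  | zero => rfl
  | succ n ih =>
    have hp : q.toRule.prob s h = q.toRule.prob t h' := by simp [StationaryRule.toRule, hb]
    have hx : ∀ x, payoffUpTo δ q.toRule F n (h.append x) =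
        payoffUpTo δ q.toRule F n (h'.append x) :=
      fun x => ih (by rw [History.best_append, History.best_append, hb])
    simp only [payoffUpTo, hp, hb, hx]

theorem payoff_toRule_congr {δ : ℝ} {q : StationaryRule} {F : Measure ℝ} {s t : ℕ}
    {h : History s} {h' : History t} (hb : h.best = h'.best) :
    payoff δ q.toRule F h = payoff δ q.toRule F h' :=
  iSup_congr fun n => payoffUpTo_toRule_congr n hb

section Binary

variable {X : Set ℝ} {z σ : ℝ}

theorem binary_eq_mixture (z σ : ℝ) : binary z σ = mixture (Measure.dirac 0) z σ := rfl

theorem isProbabilityMeasure_binary (hσ₀ : 0 ≤ σ) (hσ₁ : σ ≤ 1) :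
    IsProbabilityMeasure (binary z σ) :=
  isProbabilityMeasure_mixture hσ₀ hσ₁

theorem ae_binary {P : ℝ → Prop} (h₀ : P 0) (hz : P z) : ∀ᵐ x ∂binary z σ, P x :=
  ae_mixture (by rw [ae_dirac_eq]; exact h₀) hz

theorem integral_binary (hσ₀ : 0 ≤ σ) (hσ₁ : σ ≤ 1) (f : ℝ → ℝ) :
    ∫ x, f x ∂binary z σ = (1 - σ) * f 0 + σ * f z := by
  rw [binary_eq_mixture, integral_mixture hσ₀ hσ₁ (integrable_dirac (by simp)), integral_dirac]

theorem integrable_binary (hσ₀ : 0 ≤ σ) (hσ₁ : σ ≤ 1) (hz : 0 ≤ z) :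
    Integrable (fun x : ℝ => x) (binary z σ) := by
  have := isProbabilityMeasure_binary (z := z) hσ₀ hσ₁
  exact integrable_of_ae_mem_Icc (ae_binary le_rfl hz) (ae_binary hz le_rfl)

theorem isReservation_binary {δ c : ℝ} (hδ₀ : 0 < δ) (hδ₁ : δ < 1) (hσ₀ : 0 < σ) (hσ₁ : σ ≤ 1)
    (hc₀ : 0 ≤ c) (hc : c * (1 - δ + δ * σ) = δ * σ * z) : IsReservation δ (binary z σ) c := by
  have hcz : c ≤ z := by
    have : 0 < δ * σ := mul_pos hδ₀ hσ₀
    by_contra! hcz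
    nlinarith [mul_nonneg hc₀ (sub_nonneg.2 hδ₁.le)]
  refine ⟨hc₀, ?_⟩
  rw [integral_binary hσ₀.le hσ₁, max_eq_left hc₀, max_eq_right hcz]
  linear_combination hc

end Binary

/-! ### Tightness and improvement of feasible profiles -/

section Profile

variable {δ x₀ R : ℝ} {X : Set ℝ} {w : ℝ → ℝ}

/-- By the choice of `stopProb`, the bound is a fixed point of the payoff recursion when the
best-so-far alternative never changes. -/
theorem payoff_profileRule_le (hδ₀ : 0 < δ) (hδ₁ : δ < 1) (hR : 0 ≤ R)
    (hw : IsFeasible δ X x₀ R w) {F : Measure ℝ} [IsProbabilityMeasure F] {t : ℕ} (h : History t)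
    (hb : 0 ≤ h.best) (hF : ∀ᵐ x ∂F, x ≤ h.best) :
    payoff δ (profileRule δ w hw.mono).toRule F h ≤ ENNReal.ofReal (h.best * w h.best) := by
  refine iSup_le fun n => ?_
  induction n generalizing t with
  | zero => simp [payoffUpTo]
  | succ n ih =>
    have hW₁ := hw.le_one h.best
    refine (payoffUpTo_succ_le (f := fun _ => h.best * w h.best) hδ₀.le n h hb (integrable_const _)
      (ae_of_all _ fun _ => mul_nonneg hb (hR.trans (hw.le_val _))) (hF.mono fun x hx => ?_)).trans
      (ENNReal.ofReal_le_ofReal (le_of_eq ?_))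
    · have hbx : (h.append x).best = h.best := by rw [History.best_append, max_eq_left hx]
      simpa only [hbx] using ih (h.append x) (hbx ▸ hb) (by rw [hbx]; exact hF)
    · rw [profileRule_prob hδ₀ hδ₁ hR hw]
      simp only [integral_const, probReal_univ, smul_eq_mul, one_mul]
      linear_combination h.best * stopProb_mul hδ₀ hδ₁ hW₁

theorem toReal_payoff_binary_le (hδ₀ : 0 < δ) (hδ₁ : δ < 1) (hR : 0 ≤ R)
    (hw : IsFeasible δ X x₀ R w) {y z σ : ℝ} (hy : 0 ≤ y) (hyz : y ≤ z) (hσ₀ : 0 ≤ σ)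
    (hσ₁ : σ ≤ 1) {u : ℝ}
    (hu : u = (payoff δ (profileRule δ w hw.mono).toRule (binary z σ)
      (fun _ : Fin 1 => y : History 0)).toReal) :
    u * (1 - δ * w y) ≤
      (1 - δ) * w y * y + (1 - w y) * (δ * (1 - σ) * u + δ * σ * (z * w z)) := by
  have := isProbabilityMeasure_binary (z := z) hσ₀ hσ₁
  have hz := hy.trans hyz
  have hb := History.best_const y
  set h : History 0 := fun _ : Fin 1 => y
  have hW₁ := hw.le_one y
  obtain ⟨-, h1⟩ := toReal_payoff_le_succ (p := (profileRule δ w hw.mono).toRule) hδ₀ hδ₁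
    (ae_binary (z := z) (σ := σ) hz le_rfl) h (hb ▸ hy) (hb ▸ hyz)
  have hb0 : (h.append 0).best = y := by rw [History.best_append, hb, max_eq_left hy]
  have hbz : (h.append z).best = z := by rw [History.best_append, hb, max_eq_right hyz]
  rw [profileRule_prob hδ₀ hδ₁ hR hw, integral_binary hσ₀ hσ₁,
    payoff_toRule_congr (hb0.trans hb.symm), ← hu, hb] at h1
  have h2 : (payoff δ (profileRule δ w hw.mono).toRule (binary z σ) (h.append z)).toReal ≤
      z * w z := by
    have := payoff_profileRule_le hδ₀ hδ₁ hR hw (F := binary z σ) (h.append z)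
      (by rw [hbz]; exact hz)
      (by rw [hbz]; exact ae_binary hz le_rfl)
    rw [hbz] at this
    exact ENNReal.toReal_le_of_le_ofReal (mul_nonneg hz (hR.trans (hw.le_val z))) this
  have hpos := one_sub_mul_pos hδ₀ hδ₁ hW₁
  have hs := stopProb_mul hδ₀ hδ₁ hW₁
  have h3 : u ≤ stopProb δ (w y) * y + (1 - stopProb δ (w y)) *
      (δ * ((1 - σ) * u + σ * (z * w z))) := by
    refine h1.trans ?_
    have : 0 ≤ 1 - stopProb δ (w y) := by linarith [stopProb_le_one hδ₀ hδ₁ hW₁]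
    gcongr
  refine (mul_le_mul_of_nonneg_right h3 hpos.le).trans (le_of_eq ?_)
  linear_combination (y - δ * ((1 - σ) * u + σ * (z * w z))) * hs

theorem le_binaryRatio (hδ₀ : 0 < δ) (hδ₁ : δ < 1) (hR : 0 < R) (hR₁ : R ≤ 1)
    (hXnonneg : ∀ x ∈ X, 0 ≤ x) (hX₀ : (0 : ℝ) ∈ X) (hx₀ : 0 < x₀)
    (hw : IsFeasible δ X x₀ R w) {y : ℝ} (hy : x₀ ≤ y) :
    ENNReal.ofReal R ≤ binaryRatio δ X (profileRule δ w hw.mono) y := by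
  refine le_iInf₂ fun F hF => ?_
  obtain ⟨z, hz, σ, hσ, rfl⟩ := hF
  have := isProbabilityMeasure_binary (z := z) hσ.1 hσ.2
  have hFi := integrable_binary hσ.1 hσ.2 (hXnonneg z hz)
  have hb := History.best_const y
  have h1 := hw.mul_optPayoff_le hδ₀ hδ₁ hR hR₁ hx₀ (ae_binary (σ := σ) hX₀ hz) hFi
    (fun _ : Fin 1 => y : History 0) (hb.symm ▸ hy)
  obtain ⟨c, hc⟩ := exists_isReservation hδ₀ hδ₁ hFi
  rw [hc.optPayoff_eq hδ₀.le hδ₁ hFi _ (by rw [hb]; exact hx₀.le.trans hy)] at h1 ⊢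
  refine (ENNReal.le_div_iff_mul_le (Or.inl ?_) (Or.inl ENNReal.ofReal_ne_top)).2 h1
  rw [hb]
  exact (ENNReal.ofReal_pos.2 ((hx₀.trans_le hy).trans_le (le_max_left _ _))).ne'

theorem payoff_profileRule_of_eq_one (hδ₀ : 0 < δ) (hδ₁ : δ < 1) (hR : 0 ≤ R)
    (hw : IsFeasible δ X x₀ R w) (F : Measure ℝ) {t : ℕ} (h : History t) (h1 : w h.best = 1) :
    payoff δ (profileRule δ w hw.mono).toRule F h = ENNReal.ofReal h.best := by
  have hp : (((profileRule δ w hw.mono).toRule.prob t h : unitInterval) : ℝ) = 1 := by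
    rw [profileRule_prob hδ₀ hδ₁ hR hw, h1, stopProb, mul_one, mul_one,
      div_self (by linarith)]
  refine le_antisymm (iSup_le fun n => ?_) ?_
  · cases n with
    | zero => simp [payoffUpTo]
    | succ n => simp [payoffUpTo, hp]
  · refine le_trans ?_ (payoffUpTo_le_payoff 1 h)
    simp [payoffUpTo, hp]

/-- The rule stops at once at `y` and at `y'`, so the ratio is `y / max y c`, which increases in `y`
for each fixed environment. -/
theorem binaryRatio_le_of_eq_one (hδ₀ : 0 < δ) (hδ₁ : δ < 1) (hR : 0 ≤ R)
    (hXnonneg : ∀ x ∈ X, 0 ≤ x) (hx₀ : 0 < x₀)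
    (hw : IsFeasible δ X x₀ R w) {y y' : ℝ} (hy : x₀ ≤ y) (hyy' : y ≤ y') (h1 : w y = 1) :
    binaryRatio δ X (profileRule δ w hw.mono) y ≤ binaryRatio δ X (profileRule δ w hw.mono) y' := by
  have h1' : w y' = 1 := le_antisymm (hw.le_one y') (h1 ▸ hw.mono hyy')
  refine le_iInf₂ fun F hF => iInf₂_le_of_le F hF ?_
  obtain ⟨z, hz, σ, hσ, rfl⟩ := hF
  have := isProbabilityMeasure_binary (z := z) hσ.1 hσ.2
  have hFi := integrable_binary hσ.1 hσ.2 (hXnonneg z hz)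
  have hb := History.best_const y
  have hb' := History.best_const y'
  have hy0 := hx₀.trans_le hy
  have hy0' := hy0.trans_le hyy'
  obtain ⟨c, hc⟩ := exists_isReservation hδ₀ hδ₁ hFi
  have hm : 0 < max y c := hy0.trans_le (le_max_left _ _)
  have hm' : 0 < max y' c := hy0'.trans_le (le_max_left _ _)
  rw [hc.optPayoff_eq hδ₀.le hδ₁ hFi _ (by rw [hb]; exact hy0.le),
    hc.optPayoff_eq hδ₀.le hδ₁ hFi _ (by rw [hb']; exact hy0'.le),
    payoff_profileRule_of_eq_one hδ₀ hδ₁ hR hw _ _ (by rw [hb]; exact h1),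
    payoff_profileRule_of_eq_one hδ₀ hδ₁ hR hw _ _ (by rw [hb']; exact h1'), hb, hb',
    ← ENNReal.ofReal_div_of_pos hm, ← ENNReal.ofReal_div_of_pos hm']
  apply ENNReal.ofReal_le_ofReal
  rw [div_le_div_iff₀ hm hm', mul_max_of_nonneg _ _ hy0.le, mul_max_of_nonneg _ _ hy0'.le]
  refine max_le_max (le_of_eq (mul_comm _ _)) (mul_le_mul_of_nonneg_right hyy' hc.nonneg)

/-- If a feasible profile below one guarantees more than `R` in binary environments at `y`, then it
can be raised at and above `y`. -/
theorem IsFeasible.exists_lt (hδ₀ : 0 < δ) (hδ₁ : δ < 1) (hR : 0 < R)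
    (hXnonneg : ∀ x ∈ X, 0 ≤ x) (hx₀ : 0 < x₀)
    (hw : IsFeasible δ X x₀ R w) {y : ℝ} (hy : x₀ ≤ y) (hy₁ : w y < 1)
    (hlt : ENNReal.ofReal R < binaryRatio δ X (profileRule δ w hw.mono) y) :
    ∃ w', IsFeasible δ X x₀ R w' ∧ w y < w' y := by
  obtain ⟨r, hRr, hr⟩ := ENNReal.lt_iff_exists_nnreal_btwn.1 hlt
  rw [← ENNReal.ofReal_coe_nnreal, ENNReal.ofReal_lt_ofReal_iff_of_nonneg hR.le] at hRr
  have hy0 := hx₀.trans_le hy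
  set W := w y with hW
  have hWR : R ≤ W := hw.le_val y
  -- The payoff guarantee `r * c` turns the recursion for the actual payoff into the binary
  -- inequality with `r` in place of `R`.
  have hstrict : ∀ z ∈ X, ∀ σ, 0 < σ → σ ≤ 1 → ∀ c,
      c * (1 - δ + δ * σ) = δ * σ * z → y < c →
      r * c * (1 - δ * W) ≤
        (1 - δ) * W * y + (1 - W) * (δ * (1 - σ) * (r * c) + δ * σ * (z * w z)) := by
    intro z hz σ hσ₀ hσ₁ c hc hyc
    have hc0 := hy0.trans hyc
    have hz0 := hXnonneg z hz
    have hres := isReservation_binary hδ₀ hδ₁ hσ₀ hσ₁ hc0.le hc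
    have := isProbabilityMeasure_binary (z := z) hσ₀.le hσ₁
    have hFi := integrable_binary hσ₀.le hσ₁ hz0
    have hcz : c ≤ z := by
      have : 0 < δ * σ := mul_pos hδ₀ hσ₀
      by_contra! hcz
      nlinarith [mul_pos hc0 (sub_pos.2 hδ₁)]
    have hb := History.best_const y
    have h1 := hr.le.trans (iInf₂_le (binary z σ) ⟨z, hz, σ, ⟨hσ₀.le, hσ₁⟩, rfl⟩)
    rw [hres.optPayoff_eq hδ₀.le hδ₁ hFi _ (by rw [hb]; exact hy0.le), hb, max_eq_right hyc.le,
      ENNReal.le_div_iff_mul_le (Or.inl (ENNReal.ofReal_pos.2 hc0).ne')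
        (Or.inl ENNReal.ofReal_ne_top), ← ENNReal.ofReal_coe_nnreal,
      ← ENNReal.ofReal_mul r.coe_nonneg] at h1
    have hT := payoff_le_of_ae_le (p := (profileRule δ w hw.mono).toRule) hδ₀.le hδ₁.le
      (ae_binary (z := z) (σ := σ) hz0 le_rfl) (fun _ : Fin 1 => y : History 0)
      (by rw [hb]; exact hy0.le) (by rw [hb]; exact hyc.le.trans hcz)
    have h2 := (ENNReal.ofReal_le_iff_le_toReal
      (ne_top_of_le_ne_top ENNReal.ofReal_ne_top hT)).1 h1
    have h3 := toReal_payoff_binary_le hδ₀ hδ₁ hR.le hw hy0.le (hyc.le.trans hcz) hσ₀.le hσ₁ rfl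
    set u := (payoff δ (profileRule δ w hw.mono).toRule (binary z σ)
      (fun _ : Fin 1 => y : History 0)).toReal
    have h4 : 0 ≤ 1 - δ * W - (1 - W) * (δ * (1 - σ)) := by
      have : 0 ≤ (1 - W) * (δ * σ) := mul_nonneg (by linarith) (mul_pos hδ₀ hσ₀).le
      linarith
    have h5 := mul_le_mul_of_nonneg_right h2 h4
    linarith
  -- Replacing `r` by `R` frees at least `(r - R) * (1 - δ) * c`, while raising `W` by `ε` costs at
  -- most `ε * c`; the second term keeps the profile at most one.
  set ε := min ((r - R) * (1 - δ)) (1 - W) with hε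
  have hε0 : 0 < ε := lt_min (mul_pos (by linarith) (by linarith)) (by linarith)
  have hε1 : ε ≤ (r - R) * (1 - δ) := min_le_left _ _
  have hε2 : ε ≤ 1 - W := min_le_right _ _
  let w' : ℝ → ℝ := fun x => if x < y then w x else max (w x) (W + ε)
  have hle : ∀ x, w x ≤ w' x := fun x => by
    simp only [w']
    split_ifs
    · exact le_rfl
    · exact le_max_left _ _
  refine ⟨w', ⟨fun a b hab => ?_, fun x => (hw.le_val x).trans (hle x), fun x => ?_, ?_⟩, ?_⟩
  · by_cases ha : a < y
    · refine le_trans (le_of_eq ?_) ((hw.mono hab).trans (hle b))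
      simp [w', ha]
    · have hb : ¬ b < y := fun hb => ha (hab.trans_lt hb)
      simp only [w', ha, hb, if_false]
      exact max_le_max_right _ (hw.mono hab)
  · simp only [w']
    split_ifs
    · exact hw.le_one x
    · exact max_le (hw.le_one x) (by linarith)
  · intro x hx z hz σ hσ₀ hσ₁ c hc hxc
    have hδσ : 0 < δ * σ := mul_pos hδ₀ hσ₀
    have hz0 := hXnonneg z hz
    have hM : δ * σ * (z * w z) ≤ δ * σ * (z * w' z) := by
      have := hle z
      gcongr
    have hMz : δ * σ * (z * w z) ≤ δ * σ * z :=
      mul_le_mul_of_nonneg_left (mul_le_of_le_one_right hz0 (hw.le_one z)) hδσ.le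
    have hc0 : 0 < c := (hx₀.trans_le hx).trans hxc
    by_cases hcase : w' x = w x
    · rw [hcase]
      have h1 := hw.binary_le x hx z hz σ hσ₀ hσ₁ c hc hxc
      have h2 := mul_le_mul_of_nonneg_left hM (sub_nonneg.2 (hw.le_one x))
      linarith
    · have hxy : y ≤ x := by
        by_contra! h
        exact hcase (by simp [w', h])
      have hval : w' x = W + ε := by
        have h1 : w' x = max (w x) (W + ε) := by simp [w', not_lt.2 hxy]
        rcases max_choice (w x) (W + ε) with h2 | h2
        · exact absurd (h1.trans h2) hcase
        · exact h1.trans h2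
      rw [hval]
      have h1 := hstrict z hz σ hσ₀ hσ₁ c hc (hxy.trans_lt hxc)
      have h2 : (1 - (W + ε)) * (δ * σ * (z * w z)) ≤ (1 - (W + ε)) * (δ * σ * (z * w' z)) :=
        mul_le_mul_of_nonneg_left hM (by linarith)
      have h3 : (1 - δ) * (W + ε) * y ≤ (1 - δ) * (W + ε) * x :=
        mul_le_mul_of_nonneg_left hxy (mul_nonneg (by linarith) (by linarith))
      have h4 : 0 ≤ (r - R) * c * ((1 - W) * (δ * σ)) :=
        mul_nonneg (mul_nonneg (by linarith) hc0.le) (mul_nonneg (by linarith) hδσ.le)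
      have h5 : ε * (δ * σ * (z * w z)) ≤ ε * (c * (1 - δ + δ * σ)) := by
        rw [hc]
        exact mul_le_mul_of_nonneg_left hMz hε0.le
      have h6 : ε * (c * (1 - δ + δ * σ)) ≤ ε * c :=
        mul_le_mul_of_nonneg_left (mul_le_of_le_one_right hc0.le (by nlinarith)) hε0.le
      have h7 : ε * c ≤ (r - R) * (1 - δ) * c := mul_le_mul_of_nonneg_right hε1 hc0.le
      have h8 : 0 ≤ ε * ((1 - δ) * y) := mul_nonneg hε0.le (mul_nonneg (by linarith) hy0.le)
      have h9 : 0 ≤ ε * (δ * σ * (R * c)) :=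
        mul_nonneg hε0.le (mul_nonneg hδσ.le (mul_nonneg hR.le hc0.le))
      linarith
  · have : w' y = max (w y) (W + ε) := by simp [w']
    rw [this]
    exact lt_of_lt_of_le (by linarith) (le_max_right _ _)

/-! ### The greatest feasible profile -/

/-- The pointwise supremum of all feasible profiles. -/
def greatestProfile (δ : ℝ) (X : Set ℝ) (x₀ R : ℝ) (y : ℝ) : ℝ :=
  sSup ((fun w : ℝ → ℝ => w y) '' {w | IsFeasible δ X x₀ R w})

theorem bddAbove_feasible (y : ℝ) :
    BddAbove ((fun w : ℝ → ℝ => w y) '' {w | IsFeasible δ X x₀ R w}) :=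
  ⟨1, forall_mem_image.2 fun _ hw => hw.le_one y⟩

theorem IsFeasible.le_greatestProfile (hw : IsFeasible δ X x₀ R w) (y : ℝ) :
    w y ≤ greatestProfile δ X x₀ R y :=
  le_csSup (bddAbove_feasible y) (mem_image_of_mem _ hw)

/-- The binary inequality relaxes as the value at `z` rises and is a closed condition on the value
at `y`, so it passes to the supremum. -/
theorem isFeasible_greatestProfile (hδ₀ : 0 < δ) (hXnonneg : ∀ x ∈ X, 0 ≤ x)
    (hw : IsFeasible δ X x₀ R w) : IsFeasible δ X x₀ R (greatestProfile δ X x₀ R) := by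
  have hne : ∀ y, ((fun w : ℝ → ℝ => w y) '' {w | IsFeasible δ X x₀ R w}).Nonempty :=
    fun y => ⟨_, mem_image_of_mem _ hw⟩
  refine ⟨fun a b hab => csSup_le (hne a) (forall_mem_image.2 fun v hv =>
      (hv.mono hab).trans (hv.le_greatestProfile b)),
    fun y => (hw.le_val y).trans (hw.le_greatestProfile y),
    fun y => csSup_le (hne y) (forall_mem_image.2 fun v hv => hv.le_one y), ?_⟩
  intro y hy z hz σ hσ₀ hσ₁ c hc hyc
  set M := z * greatestProfile δ X x₀ R z
  let T : Set ℝ := {W | R * c * (1 - δ * W) ≤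
    (1 - δ) * W * y + (1 - W) * (δ * (1 - σ) * (R * c) + δ * σ * M)}
  have hT : IsClosed T := isClosed_le (by fun_prop) (by fun_prop)
  refine closure_minimal ?_ hT (csSup_mem_closure (hne y) (bddAbove_feasible y))
  refine image_subset_iff.2 fun v hv => ?_
  have h1 := hv.binary_le y hy z hz σ hσ₀ hσ₁ c hc hyc
  have h2 : δ * σ * (z * v z) ≤ δ * σ * M :=
    mul_le_mul_of_nonneg_left (mul_le_mul_of_nonneg_left (hv.le_greatestProfile z)
      (hXnonneg z hz)) (mul_pos hδ₀ hσ₀).le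
  have h3 := mul_le_mul_of_nonneg_left h2 (sub_nonneg.2 (hv.le_one y))
  change R * c * (1 - δ * v y) ≤
    (1 - δ) * v y * y + (1 - v y) * (δ * (1 - σ) * (R * c) + δ * σ * M)
  linarith

theorem monotoneRatio_greatestProfile (hδ₀ : 0 < δ) (hδ₁ : δ < 1) (hR : 0 < R) (hR₁ : R ≤ 1)
    (hXnonneg : ∀ x ∈ X, 0 ≤ x) (hX₀ : (0 : ℝ) ∈ X) (hx₀ : 0 < x₀)
    (hw : IsFeasible δ X x₀ R (greatestProfile δ X x₀ R)) :
    (profileRule δ _ hw.mono).HasMonotoneRatio δ X x₀ := by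
  intro y hy y' hy' hyy'
  rcases (hw.le_one y).lt_or_eq with h1 | h1
  · refine le_trans ?_ (le_binaryRatio hδ₀ hδ₁ hR hR₁ hXnonneg hX₀ hx₀ hw hy')
    by_contra! hlt
    obtain ⟨w', hw', hlt'⟩ := hw.exists_lt hδ₀ hδ₁ hR hXnonneg hx₀ hy h1 hlt
    exact hlt'.not_ge (hw'.le_greatestProfile y)
  · exact binaryRatio_le_of_eq_one hδ₀ hδ₁ hR.le hXnonneg hx₀ hw hy hyy' h1

theorem isMonotone_profileRule (hδ₀ : 0 < δ) (hδ₁ : δ < 1) (hw : IsFeasible δ X x₀ R w) :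
    (profileRule δ w hw.mono).IsMonotone x₀ := fun _ _ b _ hab =>
  Set.monotone_projIcc zero_le_one (stopProb_mono hδ₀ hδ₁ (hw.mono hab) (hw.le_one b))

end Profile

end RobustSearch

end

theorem proposition5 (δ : ℝ) (hδ₀ : 0 < δ) (hδ₁ : δ < 1)
    (X : Set ℝ) (hX : MeasurableSet X) (hXnonneg : ∀ x ∈ X, 0 ≤ x) (hX₀ : (0 : ℝ) ∈ X)
    (x₀ : ℝ) (hx₀ : 0 < x₀) (p : RobustSearch.DecisionRule) :
    ∃ q : RobustSearch.StationaryRule,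
      q.IsMonotone x₀ ∧
      q.HasMonotoneRatio δ X x₀ ∧
      RobustSearch.performanceRatio δ X p x₀ (RobustSearch.environments X) ≤
        RobustSearch.performanceRatio δ X q.toRule x₀ (RobustSearch.environments X) := by
  open RobustSearch in
  -- With nothing to guarantee, always stopping is a suitable rule.
  rcases eq_or_ne (performanceRatio δ X p x₀ (environments X)) 0 with h0 | h0
  · have hw : IsFeasible δ X x₀ 0 fun _ => 1 := by
      refine ⟨monotone_const, fun _ => zero_le_one, fun _ => le_rfl, ?_⟩
      intro y hy z hz σ hσ₀ hσ₁ c hc hyc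
      have : 0 ≤ (1 - δ) * y := mul_nonneg (by linarith) (hx₀.le.trans hy)
      linarith
    exact ⟨profileRule δ _ hw.mono, isMonotone_profileRule hδ₀ hδ₁ hw,
      fun y hy y' _ hyy' =>
        binaryRatio_le_of_eq_one hδ₀ hδ₁ le_rfl hXnonneg hx₀ hw hy hyy' rfl,
      h0 ▸ zero_le⟩
  have hopt : ∀ F ∈ environments X, ∀ (t : ℕ) (h : History t), h ∈ histories X x₀ t →
      optPayoff δ F h ≠ 0 ∧ optPayoff δ F h ≠ ⊤ := by
    intro F hF t h hh
    have := hF.1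
    have hb := History.le_best_of_mem hh
    obtain ⟨c, hc⟩ := exists_isReservation hδ₀ hδ₁ hF.2.2
    rw [hc.optPayoff_eq hδ₀.le hδ₁ hF.2.2 h (hx₀.le.trans hb)]
    exact ⟨(ENNReal.ofReal_pos.2 ((hx₀.trans_le hb).trans_le (le_max_left _ _))).ne',
      ENNReal.ofReal_ne_top⟩
  have H : ∀ F ∈ environments X, ∀ (t : ℕ) (h : History t), h ∈ histories X x₀ t →
      likelihood F h ≠ 0 →
      performanceRatio δ X p x₀ (environments X) * optPayoff δ F h ≤ payoff δ p F h :=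
    fun F hF t h hh hl =>
      performanceRatio_mul_le hF hh hl (hopt F hF t h hh).1 (hopt F hF t h hh).2
  have hR1 : performanceRatio δ X p x₀ (environments X) ≤ 1 := by
    have hF := isConfined_const (x₀ := x₀) hX₀ hx₀.le
    have hmem := mem_environments hXnonneg hF.ae_mem hF.ae_le
    obtain ⟨h1, h2⟩ := hopt _ hmem 0 _ hF.mem
    have h3 := (H _ hmem 0 _ hF.mem hF.likelihood_ne).trans
      (le_iSup (fun p => payoff δ p _ _) p)
    rw [← ENNReal.mul_le_mul_iff_left h1 h2, one_mul]
    exact h3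
  set R := (performanceRatio δ X p x₀ (environments X)).toReal
  have hT := ne_top_of_le_ne_top ENNReal.one_ne_top hR1
  have hRe : ENNReal.ofReal R = performanceRatio δ X p x₀ (environments X) :=
    ENNReal.ofReal_toReal hT
  have hR : 0 < R := ENNReal.toReal_pos h0 hT
  have hR₁ : R ≤ 1 := ENNReal.toReal_le_of_le_ofReal zero_le_one (by simpa using hR1)
  rw [← hRe] at H ⊢
  have hw := isFeasible_greatestProfile hδ₀ hXnonneg
    (isFeasible_ruleProfile hδ₀ hδ₁ hR hXnonneg hX₀ hx₀ H)
  refine ⟨profileRule δ _ hw.mono, isMonotone_profileRule hδ₀ hδ₁ hw,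
    monotoneRatio_greatestProfile hδ₀ hδ₁ hR hR₁ hXnonneg hX₀ hx₀ hw,
    le_performanceRatio hδ₀ hδ₁ hx₀ fun F hF t h hb => ?_⟩
  have := hF.1
  exact hw.mul_optPayoff_le hδ₀ hδ₁ hR hR₁ hx₀ (mem_ae_iff.2 hF.2.1) hF.2.2 h hb
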